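/- **Setting.** Inputs lie in a set $\mathcal X\subseteq\mathbb R^d$. A one-hidden-layer network of width $m$ with measurable activation $\sigma:\mathbb R\to\mathbb R$ has lower-layer weights $w_1,\dots,w_m\in\mathbb R^d$ drawn i.i.d. from a probability distribution $\nu$ (e.g. Gaussian) and then frozen, and output $x\mapsto a\cdot h(x)$, where $h(x)=m^{-1/2}(\sigma(w_1\cdot x),\dots,\sigma(w_m\cdot x))$. For data points $x_1,\dots,x_n$ let $\mathbf h$ be the $n\times m$ matrix with rows $h(x_i)$, and let $H^\infty=\mathrm E[\mathbf h\mathbf h^{T}]$ be the NNGP Gram matrix, i.e. $H^\infty_{ik}=K(x_i,x_k)$ with $K(x,x')=\mathrm E_{w\sim\nu}[\sigma(w\cdot x)\sigma(w\cdot x')]$. Assume that for every $x\in\mathcal X$ the variable $\sigma(w\cdot x)$ is square integrable and $K(x,x)\le\kappa$ (on the unit sphere with standard Gaussian weights, $K(x,x)$ is a constant determined by $\sigma$). The final-layer weights $a$ are trained from $0$ by $T$ steps of SGD with learning rate $\eta$ on the squared training error $\tfrac12(a\cdot h(x_i)-y_i)^2$, each step on an independent uniformly chosen example $i$ (no step is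 made if there are no examples). Let $\ell(y,z)\in[0,b]$ be a measurable loss that is $1$-Lipschitz in the prediction $z$ and satisfies $\ell(y,y)=0$. For a measurable target $g:\mathbb R^d\to\mathbb R$ and a distribution $D$, the sample complexity $n_{g,D}(\epsilon,\delta)$ of an algorithm is the smallest integer $n\ge 0$ such that from $n$ i.i.d. examples $(x_i,g(x_i))$, $x_i\sim D$, it produces with probability greater than $1-\delta$ (over the examples and its own randomness) a model $\hat g$ with $\mathrm E_{x\sim D}[\ell(g(x),\hat g(x))]<\epsilon$ (and $\infty$ if there is no such $n$). **Theorem.** For all $\kappa$ and $b$ there are constants $C>0$ and $\eta_0>0$, depending only on $\kappa$ and $b$, such that the following holds for all $d,\sigma,\nu,\mathcal X,\ell$ as above, every measurable $g$ and every real $M_g$. Let $D$ be any probability distribution on $\mathcal X$ such that for every $n$ and almost every sample $x_1,\dots,x_n$ from $D$ whose points are distinct, $H^\infty$ is invertible and $$\mathbf y^{T}(H^\infty)^{-1}\mathbf y\le M_g,\qquad \mathbf y=(g(x_1),\dots,g(x_n))^T .$$ Then for all $\epsilon>0$ and $\delta\in(0,1)$, for all sufficiently large widths $m$, all learning rates $0<\eta<\eta_0$,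 and all sufficiently large numbers of steps $T$ (depending also on $m$ and $\eta$), the sample complexity of training only the final-layer weights with SGD satisfies $$n_{g,D}(\epsilon,\delta)\le \frac{C\,[M_g+\log(\delta^{-1})]}{\epsilon^2}.$$ That is, $g$ is efficiently learned, with constant $M_g$ equal to any upper bound of $\mathbf y^{T}(H^\infty)^{-1}\mathbf y$. -/

import Mathlib

open MeasureTheory Filter
open scoped ENNReal Matrix InnerProductSpace

/-- A randomized learning algorithm for real-valued functions on `X`: from `n` inputs, their labels
and a random seed it produces a trained model `X → ℝ`. -/
structure RandomizedLearner (X : Type) where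
  Seed : ℕ → Type
  mSeed : ∀ n, MeasurableSpace (Seed n)
  law : ∀ n, Measure (Seed n)
  isProb : ∀ n, IsProbabilityMeasure (law n)
  train : ∀ n, (Fin n → X) → (Fin n → ℝ) → Seed n → X → ℝ

attribute [instance] RandomizedLearner.mSeed RandomizedLearner.isProb

/-- Generalization error `E_{x ∼ D} [ℓ (g x, f x)]` of the model `f` for the target `g`. -/
noncomputable def genError {X : Type} [MeasurableSpace X] (D : Measure X) (ℓ : ℝ → ℝ → ℝ)
    (g f : X → ℝ) : ℝ :=
  ∫ x, ℓ (g x) (f x) ∂D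

/-- Given `n` i.i.d. examples of `g` on `D`, the algorithm produces, with probability greater than
`1 - δ` over the examples and its own randomness, a model of generalization error less than `ε`. -/
def LearnsFrom {X : Type} [MeasurableSpace X] (A : RandomizedLearner X) (D : Measure X)
    (ℓ : ℝ → ℝ → ℝ) (g : X → ℝ) (ε δ : ℝ) (n : ℕ) : Prop :=
  ENNReal.ofReal (1 - δ) <
    ((Measure.pi fun _ : Fin n => D).prod (A.law n))
      {ω | genError D ℓ g (A.train n ω.1 (fun i => g (ω.1 i)) ω.2) < ε}

/-- Sample complexity: the smallest number of examples that suffices (`⊤` if none does). -/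
noncomputable def sampleComplexity {X : Type} [MeasurableSpace X] (A : RandomizedLearner X)
    (D : Measure X) (ℓ : ℝ → ℝ → ℝ) (g : X → ℝ) (ε δ : ℝ) : ℕ∞ :=
  sInf ((fun n : ℕ => (n : ℕ∞)) '' {n : ℕ | LearnsFrom A D ℓ g ε δ n})

/-- A `1`-Lipschitz loss `ℓ (target, prediction)` with values in `[0, b]`, vanishing when the
prediction equals the target. -/
structure IsLipschitzLoss (ℓ : ℝ → ℝ → ℝ) (b : ℝ) : Prop where
  measurable : Measurable (Function.uncurry ℓ)
  lipschitz : ∀ y, LipschitzWith 1 (ℓ y)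
  diag : ∀ y, ℓ y y = 0
  nonneg : ∀ y z, 0 ≤ ℓ y z
  le : ∀ y z, ℓ y z ≤ b

section Network

variable {d : ℕ}

/-- Hidden-layer activations, as a row of length `m`, at the input `x`, for lower-layer weights `W`;
the factor `1 / √m` makes the Gram matrix an average over hidden units. -/
noncomputable def hiddenRow (σ : ℝ → ℝ) (m : ℕ) (W : Fin m → EuclideanSpace ℝ (Fin d))
    (x : EuclideanSpace ℝ (Fin d)) : Fin m → ℝ :=
  fun j => σ ⟪W j, x⟫_ℝ / √(m : ℝ)

/-- The `n × m` matrix `h` of hidden-layer activations on the data points `x`. -/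
noncomputable def hiddenMatrix (σ : ℝ → ℝ) (m : ℕ) (W : Fin m → EuclideanSpace ℝ (Fin d))
    {n : ℕ} (x : Fin n → EuclideanSpace ℝ (Fin d)) : Matrix (Fin n) (Fin m) ℝ :=
  Matrix.of fun i => hiddenRow σ m W (x i)

/-- The NNGP kernel `E_{w ∼ ν} [σ (w · x) σ (w · x')]`. -/
noncomputable def nngpKernel (σ : ℝ → ℝ) (ν : Measure (EuclideanSpace ℝ (Fin d)))
    (x x' : EuclideanSpace ℝ (Fin d)) : ℝ :=
  ∫ w, σ ⟪w, x⟫_ℝ * σ ⟪w, x'⟫_ℝ ∂ν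

/-- The NNGP Gram matrix of the data points `x`; it equals `E [h hᵀ]` at every width `m ≥ 1`, see
`integral_hiddenMatrix_mul_transpose`. -/
noncomputable def nngpGram (σ : ℝ → ℝ) (ν : Measure (EuclideanSpace ℝ (Fin d)))
    {n : ℕ} (x : Fin n → EuclideanSpace ℝ (Fin d)) : Matrix (Fin n) (Fin n) ℝ :=
  Matrix.of fun i k => nngpKernel σ ν (x i) (x k)

theorem integral_hiddenMatrix_mul_transpose (σ : ℝ → ℝ)
    (ν : Measure (EuclideanSpace ℝ (Fin d))) [IsProbabilityMeasure ν] {m n : ℕ} (hm : m ≠ 0)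
    (x : Fin n → EuclideanSpace ℝ (Fin d)) (hx : ∀ i, MemLp (fun w => σ ⟪w, x i⟫_ℝ) 2 ν)
    (i k : Fin n) :
    ∫ W, (hiddenMatrix σ m W x * (hiddenMatrix σ m W x)ᵀ) i k ∂(Measure.pi fun _ : Fin m => ν)
      = nngpGram σ ν x i k := by
  have hint : Integrable (fun w => σ ⟪w, x i⟫_ℝ * σ ⟪w, x k⟫_ℝ) ν :=
    (hx i).integrable_mul (hx k)
  have hm' : (m : ℝ) ≠ 0 := by exact_mod_cast hm
  have hsq : √(m : ℝ) * √(m : ℝ) = m := Real.mul_self_sqrt (Nat.cast_nonneg m)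
  have hpt : ∀ W : Fin m → EuclideanSpace ℝ (Fin d),
      (hiddenMatrix σ m W x * (hiddenMatrix σ m W x)ᵀ) i k
        = ∑ j, (σ ⟪W j, x i⟫_ℝ * σ ⟪W j, x k⟫_ℝ) / m := by
    intro W
    simp only [Matrix.mul_apply, Matrix.transpose_apply, hiddenMatrix, Matrix.of_apply, hiddenRow]
    refine Finset.sum_congr rfl fun j _ => ?_
    rw [div_mul_div_comm, hsq]
  simp_rw [hpt]
  have hmp : ∀ j : Fin m, MeasurePreserving (Function.eval j)
      (Measure.pi fun _ : Fin m => ν) ν := fun j => measurePreserving_eval _ j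
  have hint' : ∀ j ∈ (Finset.univ : Finset (Fin m)),
      Integrable (fun W : Fin m → EuclideanSpace ℝ (Fin d) =>
        (σ ⟪W j, x i⟫_ℝ * σ ⟪W j, x k⟫_ℝ) / (m : ℝ)) (Measure.pi fun _ : Fin m => ν) :=
    fun j _ => ((hmp j).integrable_comp_of_integrable hint).div_const _
  rw [integral_finsetSum _ hint']
  have hj : ∀ j : Fin m, ∫ W : Fin m → EuclideanSpace ℝ (Fin d),
      (σ ⟪W j, x i⟫_ℝ * σ ⟪W j, x k⟫_ℝ) / m ∂(Measure.pi fun _ : Fin m => ν)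
        = nngpKernel σ ν (x i) (x k) / m := by
    intro j
    rw [integral_div]
    congr 1
    have h2 := integral_map (μ := Measure.pi fun _ : Fin m => ν) (hmp j).measurable.aemeasurable
      (f := fun w => σ ⟪w, x i⟫_ℝ * σ ⟪w, x k⟫_ℝ)
      (by rw [(hmp j).map_eq]; exact hint.aestronglyMeasurable)
    rw [(hmp j).map_eq] at h2
    exact h2.symm
  simp only [hj, Finset.sum_const, Finset.card_univ, Fintype.card_fin, nsmul_eq_mul, nngpGram,
    Matrix.of_apply]
  field_simp

/-- One SGD step for the final-layer weights `a` on the squared error `(h_k · a - y_k)² / 2` of the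
`k`-th example (no step if there is no such example). -/
noncomputable def sgdStep (η : ℝ) {n m : ℕ} (h : Matrix (Fin n) (Fin m) ℝ) (y : Fin n → ℝ)
    (a : Fin m → ℝ) (k : ℕ) : Fin m → ℝ :=
  if hk : k < n then a - (η * (h ⟨k, hk⟩ ⬝ᵥ a - y ⟨k, hk⟩)) • h ⟨k, hk⟩ else a

/-- Final-layer weights after `T` SGD steps from `0`, on the examples numbered `e 0, …, e (T-1)`. -/
noncomputable def sgdWeights (η : ℝ) {n m : ℕ} (h : Matrix (Fin n) (Fin m) ℝ) (y : Fin n → ℝ)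
    (T : ℕ) (e : Fin T → ℕ) : Fin m → ℝ :=
  Fin.foldl T (fun a t => sgdStep η h y a (e t)) 0

/-- Law of the number of a randomly chosen training example: uniform on `{0, …, n - 1}` (a dummy
value if there are no examples). -/
noncomputable def exampleLaw (n : ℕ) : PMF ℕ :=
  if hn : n = 0 then PMF.pure 0
  else PMF.uniformOfFinset (Finset.range n) (Finset.nonempty_range_iff.2 hn)

/-- The one-hidden-layer network of width `m` with activation `σ`: the lower-layer weights are drawn
i.i.d. from `ν` and frozen, the final-layer weights are trained from `0` by `T` steps of SGD with
learning rate `η` on the squared training error, each step on an independent uniformly chosen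
example. -/
noncomputable def sgdLearner (σ : ℝ → ℝ) (ν : Measure (EuclideanSpace ℝ (Fin d)))
    [IsProbabilityMeasure ν] (m : ℕ) (η : ℝ) (T : ℕ) :
    RandomizedLearner (EuclideanSpace ℝ (Fin d)) where
  Seed _ := (Fin m → EuclideanSpace ℝ (Fin d)) × (Fin T → ℕ)
  mSeed _ := inferInstance
  law n := (Measure.pi fun _ : Fin m => ν).prod
    (Measure.pi fun _ : Fin T => (exampleLaw n).toMeasure)
  isProb _ := inferInstance
  train _ x y s := fun z =>
    hiddenRow σ m s.1 z ⬝ᵥ sgdWeights η (hiddenMatrix σ m s.1 x) y _ s.2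

/-- For almost every finite sample from `D` with distinct data points, the NNGP Gram matrix `H` is
invertible and `yᵀ H⁻¹ y ≤ M`, where `y` is the vector of values of `g`. -/
def GramBound (σ : ℝ → ℝ) (ν : Measure (EuclideanSpace ℝ (Fin d)))
    (D : Measure (EuclideanSpace ℝ (Fin d))) (g : EuclideanSpace ℝ (Fin d) → ℝ) (M : ℝ) : Prop :=
  ∀ n : ℕ, ∀ᵐ x ∂(Measure.pi fun _ : Fin n => D), Function.Injective x →
    IsUnit (nngpGram σ ν x) ∧
      (fun i => g (x i)) ⬝ᵥ ((nngpGram σ ν x)⁻¹ *ᵥ fun i => g (x i)) ≤ M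

end Network

/-! ### Product measures and McDiarmid's inequality -/

section ProductMeasure

variable {α : Type*} [MeasurableSpace α]

/-! With the hidden weights frozen, the network is a linear predictor in random features, so the
claim combines three facts: a small-norm interpolator exists, SGD converges to it, and small-norm
linear predictors generalize.

Interpolation. By the strong law of large numbers the empirical Gram matrix `G` of the hidden layer
converges to the NNGP Gram matrix as the width grows. Hence `y ⬝ᵥ G⁻¹ *ᵥ y` is eventually at most
any `M' > M`, and `s = hᵀ G⁻¹ y` is an interpolator in the row span with squared norm at most `M'`
(`tendsto_measure_not_isGoodDraw`, `IsGoodDraw.exists_interpolation`).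

Optimization. Since `s` interpolates, an SGD step acts linearly on the error `a - s`, and for small
`η` never lengthens it. Started at `0`, SGD therefore keeps squared norm at most `4 M'`
deterministically. The error also stays in the row span, where the average step contracts strictly,
so the training loss tends to `0` in probability (`sgdWeights_dotProduct_self_le`,
`tendsto_measure_trainingLoss`).

Generalization. For fixed hidden weights, symmetrization, contraction and McDiarmid bound the
deviation between expected and empirical loss uniformly over a ball of final-layer weights. Only the
mean square of the features enters, and this is again controlled by the law of large numbers
(`exists_measurableSet_deviation_le`).

A union bound over the three failure events gives learning from `n` examples
(`eventually_learnsFrom`). The number of examples used is the floor of the claimed bound. When that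
floor is `0`, the zero predictor is already good enough, because the Gram bound for one point gives
`g x ^ 2 ≤ M * K(x, x)` (`learnsFrom_zero`). -/

theorem measurePreserving_finCons (μ : Measure α) [IsProbabilityMeasure μ] (n : ℕ) :
    MeasurePreserving (fun p : α × (Fin n → α) => (Fin.cons p.1 p.2 : Fin (n + 1) → α))
      (μ.prod (Measure.pi fun _ => μ)) (Measure.pi fun _ => μ) := by
  have h := (measurePreserving_piFinSuccAbove (fun _ : Fin (n + 1) => μ) 0).symm
  convert h using 1
  ext p : 1
  simp [MeasurableEquiv.piFinSuccAbove, Fin.insertNthEquiv]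

theorem measurable_finCons (n : ℕ) :
    Measurable (fun p : α × (Fin n → α) => (Fin.cons p.1 p.2 : Fin (n + 1) → α)) := by
  refine measurable_pi_lambda _ fun i => ?_
  refine Fin.cases ?_ (fun j => ?_) i
  · simpa using measurable_fst
  · simp only [Fin.cons_succ]
    fun_prop

theorem integrable_pi_succ_iff (μ : Measure α) [IsProbabilityMeasure μ] {n : ℕ}
    {F : (Fin (n + 1) → α) → ℝ} (hm : Measurable F) :
    Integrable F (Measure.pi fun _ => μ) ↔
      Integrable (fun p : α × (Fin n → α) => F (Fin.cons p.1 p.2))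
        (μ.prod (Measure.pi fun _ => μ)) :=
  ((measurePreserving_finCons μ n).integrable_comp hm.aestronglyMeasurable).symm

theorem integral_pi_succ (μ : Measure α) [IsProbabilityMeasure μ] {n : ℕ}
    {F : (Fin (n + 1) → α) → ℝ} (hm : Measurable F)
    (hF : Integrable F (Measure.pi fun _ => μ)) :
    ∫ x, F x ∂(Measure.pi fun _ => μ)
      = ∫ x', ∫ x₀, F (Fin.cons x₀ x') ∂μ ∂(Measure.pi fun _ : Fin n => μ) := by
  rw [← (measurePreserving_finCons μ n).map_eq, integral_map
    (measurable_finCons n).aemeasurable hm.aestronglyMeasurable, integral_prod_symm]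
  exact (integrable_pi_succ_iff μ hm).1 hF

theorem lintegral_pi_succ (μ : Measure α) [IsProbabilityMeasure μ] {n : ℕ}
    {F : (Fin (n + 1) → α) → ℝ≥0∞} (hm : Measurable F) :
    ∫⁻ x, F x ∂(Measure.pi fun _ => μ)
      = ∫⁻ x₀, ∫⁻ x', F (Fin.cons x₀ x') ∂(Measure.pi fun _ : Fin n => μ) ∂μ := by
  rw [← (measurePreserving_finCons μ n).map_eq, lintegral_map hm (measurable_finCons n),
    lintegral_prod (fun p : α × (Fin n → α) => F (Fin.cons p.1 p.2))
      (hm.comp (measurable_finCons n)).aemeasurable]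

theorem integrable_of_abs_le {μ : Measure α} [IsFiniteMeasure μ] {f : α → ℝ} (hf : Measurable f)
    {K : ℝ} (hK : ∀ x, |f x| ≤ K) : Integrable f μ :=
  Integrable.of_bound hf.aestronglyMeasurable K (Eventually.of_forall hK)

/-- Hoeffding's lemma for a function whose oscillation is at most `c`. -/
theorem integral_exp_sub_integral_le (μ : Measure α) [IsProbabilityMeasure μ] {f : α → ℝ}
    (hf : Measurable f) {c : ℝ} (hc : ∀ x y, f x - f y ≤ c) (t : ℝ) :
    ∫ x, Real.exp (t * (f x - ∫ y, f y ∂μ)) ∂μ ≤ Real.exp (c ^ 2 * t ^ 2 / 8) := by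
  obtain ⟨x₀⟩ : Nonempty α := μ.nonempty_of_neZero
  -- Bounded oscillation puts `f` in an interval of length `c` starting at its infimum, which is the
  -- form Hoeffding's lemma needs.
  have hbdd : BddBelow (Set.range f) :=
    ⟨f x₀ - c, by rintro _ ⟨y, rfl⟩; linarith [hc x₀ y]⟩
  have hmem : ∀ x, f x ∈ Set.Icc (⨅ y, f y) ((⨅ y, f y) + c) := by
    intro x
    have : Nonempty α := ⟨x₀⟩
    refine ⟨ciInf_le hbdd x, ?_⟩
    have := le_ciInf (f := f) (c := f x - c) fun y => by linarith [hc x y]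
    linarith
  have h := (ProbabilityTheory.hasSubgaussianMGF_of_mem_Icc (μ := μ) hf.aemeasurable
    (Eventually.of_forall hmem)).mgf_le t
  simp only [ProbabilityTheory.mgf, add_sub_cancel_left] at h
  refine h.trans (Real.exp_le_exp.2 (le_of_eq ?_))
  push_cast
  rw [div_pow, Real.norm_eq_abs, sq_abs]
  ring

/-- McDiarmid's inequality, in the form of a bound on the moment generating function. -/
theorem integral_exp_sub_integral_le_of_bounded_differences (μ : Measure α)
    [IsProbabilityMeasure μ] (c t : ℝ) : ∀ (n : ℕ) (F : (Fin n → α) → ℝ), Measurable F →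
      (∃ K, ∀ x, |F x| ≤ K) → (∀ x i z z', F (Function.update x i z)
        - F (Function.update x i z') ≤ c) →
      ∫ x, Real.exp (t * (F x - ∫ y, F y ∂(Measure.pi fun _ => μ))) ∂(Measure.pi fun _ => μ)
        ≤ Real.exp (n * (c ^ 2 * t ^ 2 / 8)) := by
  intro n
  induction n with
  | zero =>
    intro F hF _ _
    have h0 : ∀ x, F x = F default := fun x => congrArg F (Subsingleton.elim _ _)
    simp [h0]
  | succ n ih =>
    rintro F hF ⟨K, hK⟩ hd
    set P := Measure.pi fun _ : Fin n => μ with hP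
    have hFc : Measurable fun p : α × (Fin n → α) => F (Fin.cons p.1 p.2) :=
      hF.comp (measurable_finCons n)
    have hsec : ∀ x' : Fin n → α, Measurable fun x₀ => F (Fin.cons x₀ x') := fun x' =>
      hFc.comp (measurable_id.prodMk measurable_const)
    -- Averaging out one coordinate preserves the bounded differences. Induction on `G` thus
    -- replaces the usual martingale argument.
    set G : (Fin n → α) → ℝ := fun x' => ∫ x₀, F (Fin.cons x₀ x') ∂μ with hG
    have hGm : Measurable G :=
      (hFc.stronglyMeasurable.integral_prod_left' (μ := μ)).measurable
    have hGK : ∀ x', |G x'| ≤ K := by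
      intro x'
      have := norm_integral_le_of_norm_le_const (μ := μ) (f := fun x₀ => F (Fin.cons x₀ x'))
        (C := K) (Eventually.of_forall fun _ => hK _)
      simpa using this
    have hGd : ∀ x i z z', G (Function.update x i z) - G (Function.update x i z') ≤ c := by
      intro x i z z'
      have hi : ∀ w, Integrable (fun x₀ => F (Fin.cons x₀ (Function.update x i w))) μ :=
        fun w => integrable_of_abs_le (hsec _) fun _ => hK _
      simp only [hG]
      rw [← integral_sub (hi z) (hi z')]
      have : ∫ x₀, (F (Fin.cons x₀ (Function.update x i z))
          - F (Fin.cons x₀ (Function.update x i z'))) ∂μ ≤ ∫ _, c ∂μ := by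
        refine integral_mono ((hi z).sub (hi z')) (integrable_const _) fun x₀ => ?_
        have := hd (Fin.cons x₀ x) i.succ z z'
        simpa only [Fin.cons_update] using this
      simpa using this
    have hint : ∫ y, F y ∂(Measure.pi fun _ => μ) = ∫ x', G x' ∂P :=
      integral_pi_succ μ hF (integrable_of_abs_le hF hK)
    set e := ∫ x', G x' ∂P with he
    have heK : |e| ≤ K := by
      have := norm_integral_le_of_norm_le_const (μ := P) (f := G)
        (C := K) (Eventually.of_forall fun _ => hGK _)
      simpa using this
    have hEm : Measurable fun x : Fin (n + 1) → α => Real.exp (t * (F x - e)) := by fun_prop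
    have hexp : ∀ u v : ℝ, |u| ≤ K → |v| ≤ K →
        |Real.exp (t * (u - v))| ≤ Real.exp (|t| * (2 * K)) := by
      intro u v hu hv
      rw [Real.abs_exp, Real.exp_le_exp]
      calc t * (u - v) ≤ |t * (u - v)| := le_abs_self _
        _ = |t| * |u - v| := abs_mul _ _
        _ ≤ |t| * (2 * K) := by
          gcongr
          linarith [abs_sub u v]
    rw [hint, integral_pi_succ μ hEm (integrable_of_abs_le hEm fun x => hexp _ _ (hK x) heK)]
    have hinner : ∀ x', ∫ x₀, Real.exp (t * (F (Fin.cons x₀ x') - e)) ∂μ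
        ≤ Real.exp (t * (G x' - e)) * Real.exp (c ^ 2 * t ^ 2 / 8) := by
      intro x'
      have h1 : ∀ x₀, Real.exp (t * (F (Fin.cons x₀ x') - e))
          = Real.exp (t * (G x' - e)) * Real.exp (t * (F (Fin.cons x₀ x') - G x')) := by
        intro x₀
        rw [← Real.exp_add]
        ring_nf
      simp only [h1]
      rw [integral_const_mul]
      gcongr
      refine integral_exp_sub_integral_le μ (hsec x') (fun z z' => ?_) t
      simpa only [Fin.update_cons_zero] using hd (Fin.cons z x') 0 z z'
    have hGe : Integrable (fun x' => Real.exp (t * (G x' - e))) P :=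
      integrable_of_abs_le (by fun_prop) fun x' => hexp _ _ (hGK x') heK
    calc ∫ x', ∫ x₀, Real.exp (t * (F (Fin.cons x₀ x') - e)) ∂μ ∂P
        ≤ ∫ x', Real.exp (t * (G x' - e)) * Real.exp (c ^ 2 * t ^ 2 / 8) ∂P := by
          refine integral_mono_of_nonneg (Eventually.of_forall fun x' =>
            integral_nonneg fun _ => (Real.exp_pos _).le) (hGe.mul_const _)
            (Eventually.of_forall hinner)
      _ ≤ Real.exp (n * (c ^ 2 * t ^ 2 / 8)) * Real.exp (c ^ 2 * t ^ 2 / 8) := by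
          rw [integral_mul_const]
          gcongr
          exact ih G hGm ⟨K, hGK⟩ hGd
      _ = Real.exp ((n + 1 : ℕ) * (c ^ 2 * t ^ 2 / 8)) := by
          rw [← Real.exp_add]
          push_cast
          ring_nf

/-- McDiarmid's inequality. -/
theorem measureReal_ge_le_of_bounded_differences (μ : Measure α) [IsProbabilityMeasure μ]
    {c s : ℝ} (hc : 0 < c) (hs : 0 < s) {n : ℕ} (hn : 0 < n) {F : (Fin n → α) → ℝ}
    (hF : Measurable F) (hK : ∃ K, ∀ x, |F x| ≤ K)
    (hd : ∀ x i z z', F (Function.update x i z) - F (Function.update x i z') ≤ c) :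
    (Measure.pi fun _ => μ).real {x | s ≤ F x - ∫ y, F y ∂(Measure.pi fun _ => μ)}
      ≤ Real.exp (-(2 * s ^ 2 / (n * c ^ 2))) := by
  have hn' : (0 : ℝ) < n := by exact_mod_cast hn
  obtain ⟨K, hK⟩ := hK
  set e := ∫ y, F y ∂(Measure.pi fun _ => μ) with he
  -- The minimizer of the Chernoff exponent `-t * s + n * c ^ 2 * t ^ 2 / 8`.
  set t : ℝ := 4 * s / (n * c ^ 2) with ht
  have ht0 : 0 ≤ t := by positivity
  have hi : Integrable (fun x => Real.exp (t * (F x - e))) (Measure.pi fun _ : Fin n => μ) := by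
    refine integrable_of_abs_le (K := Real.exp (t * (K - e))) (by fun_prop) fun x => ?_
    rw [Real.abs_exp, Real.exp_le_exp]
    gcongr
    exact (le_abs_self _).trans (hK x)
  refine (ProbabilityTheory.measure_ge_le_exp_mul_mgf s ht0 hi).trans ?_
  have hm := integral_exp_sub_integral_le_of_bounded_differences μ c t n F hF ⟨K, hK⟩ hd
  calc Real.exp (-t * s) * ProbabilityTheory.mgf (fun x => F x - e) (Measure.pi fun _ => μ) t
      ≤ Real.exp (-t * s) * Real.exp (n * (c ^ 2 * t ^ 2 / 8)) := by gcongr; exact hm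
    _ = Real.exp (-(2 * s ^ 2 / (n * c ^ 2))) := by
      rw [← Real.exp_add]
      congr 1
      rw [ht]
      field_simp
      ring

end ProductMeasure

/-! ### Symmetrization and contraction over finite index sets -/

section Symmetrization

variable {ι α β : Type*} [Finite ι] [Nonempty ι] [MeasurableSpace α] [MeasurableSpace β]

theorem abs_ciSup_le_sum [Fintype ι] (w : ι → ℝ) : |⨆ i, w i| ≤ ∑ i, |w i| := by
  obtain ⟨i, hi⟩ := exists_eq_ciSup_of_finite (f := w)
  rw [← hi]
  exact Finset.single_le_sum (f := fun i => |w i|) (fun _ _ => abs_nonneg _) (Finset.mem_univ i)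

theorem integrable_ciSup {μ : Measure α} {w : ι → α → ℝ} (hw : ∀ i, Integrable (w i) μ) :
    Integrable (fun x => ⨆ i, w i x) μ := by
  have := Fintype.ofFinite ι
  refine Integrable.mono' (integrable_finsetSum Finset.univ fun i _ => (hw i).abs)
    (AEMeasurable.iSup fun i => (hw i).aemeasurable).aestronglyMeasurable
    (Eventually.of_forall fun x => ?_)
  exact abs_ciSup_le_sum fun i => w i x

/-- Two-point contraction inequality for suprema of Rademacher processes. -/
theorem ciSup_add_ciSup_sub_le {c φ u : ι → ℝ} (h : ∀ i j, |φ i - φ j| ≤ |u i - u j|) :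
    (⨆ i, (c i + φ i)) + (⨆ i, (c i - φ i)) ≤ (⨆ i, (c i + u i)) + (⨆ i, (c i - u i)) := by
  obtain ⟨i, hi⟩ := exists_eq_ciSup_of_finite (f := fun i => c i + φ i)
  obtain ⟨j, hj⟩ := exists_eq_ciSup_of_finite (f := fun i => c i - φ i)
  have hp : ∀ k, c k + u k ≤ ⨆ i, (c i + u i) := le_ciSup (Set.finite_range _).bddAbove
  have hm : ∀ k, c k - u k ≤ ⨆ i, (c i - u i) := le_ciSup (Set.finite_range _).bddAbove
  rw [← hi, ← hj]
  have h1 := (le_abs_self _).trans (h i j)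
  -- The sign of `u i - u j` decides which of the two maximizers is tested in the `+ u` supremum and
  -- which in the `- u` one.
  rcases abs_cases (u i - u j) with ⟨h2, _⟩ | ⟨h2, _⟩
  · linarith [hp i, hm j]
  · linarith [hp j, hm i]

/-- One step of symmetrization and contraction. -/
theorem integral_ciSup_add_integral_sub_le (μ : Measure α) [IsProbabilityMeasure μ]
    {f u : ι → α → ℝ} (hf : ∀ i, Integrable (f i) μ) (hu : ∀ i, Integrable (u i) μ)
    (h : ∀ x i j, |f i x - f j x| ≤ |u i x - u j x|) (c : ι → ℝ) :
    ∫ x, ⨆ i, (c i + (∫ y, f i y ∂μ - f i x)) ∂μ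
      ≤ ∫ x, ((⨆ i, (c i + 2 * u i x)) + ⨆ i, (c i - 2 * u i x)) / 2 ∂μ := by
  have hc : ∀ i, Integrable (fun _ : α => c i) μ := fun i => integrable_const _
  have hfp := integrable_ciSup (ι := ι) fun i => (hc i).add ((hf i).const_mul 2)
  have hfm := integrable_ciSup (ι := ι) fun i => (hc i).sub ((hf i).const_mul 2)
  have hup := integrable_ciSup (ι := ι) fun i => (hc i).add ((hu i).const_mul 2)
  have hum := integrable_ciSup (ι := ι) fun i => (hc i).sub ((hu i).const_mul 2)
  simp only [Pi.add_apply, Pi.sub_apply] at hfp hfm hup hum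
  have hbd : ∀ w : ι → ℝ, BddAbove (Set.range w) := fun w => (Set.finite_range w).bddAbove
  -- Each term is the mean of `c i + 2 * ∫ f i` and `c i - 2 * f i x`. Exchanging supremum and
  -- integral in the first half symmetrizes without a ghost sample.
  have h1 : ∀ i, c i + 2 * ∫ y, f i y ∂μ ≤ ∫ x, ⨆ i, (c i + 2 * f i x) ∂μ := by
    intro i
    have : ∫ x, (c i + 2 * f i x) ∂μ = c i + 2 * ∫ y, f i y ∂μ := by
      rw [integral_add (hc i) ((hf i).const_mul 2), integral_const_mul]
      simp
    rw [← this]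
    exact integral_mono ((hc i).add ((hf i).const_mul 2)) hfp fun x =>
      le_ciSup (hbd fun i => c i + 2 * f i x) i
  calc ∫ x, ⨆ i, (c i + (∫ y, f i y ∂μ - f i x)) ∂μ
      ≤ ∫ x, ((∫ x, ⨆ i, (c i + 2 * f i x) ∂μ) + ⨆ i, (c i - 2 * f i x)) / 2 ∂μ := by
        refine integral_mono (integrable_ciSup fun i =>
          (hc i).add ((integrable_const _).sub (hf i)))
          (((integrable_const _).add hfm).div_const 2) fun x => ciSup_le fun i => ?_
        have := le_ciSup (hbd fun i => c i - 2 * f i x) i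
        have := h1 i
        dsimp only at *
        linarith
    _ = ∫ x, ((⨆ i, (c i + 2 * f i x)) + ⨆ i, (c i - 2 * f i x)) / 2 ∂μ := by
        rw [integral_div, integral_div, integral_add (integrable_const _) hfm,
          integral_add hfp hfm]
        simp
    _ ≤ _ := by
        refine integral_mono ((hfp.add hfm).div_const 2) ((hup.add hum).div_const 2) fun x => ?_
        have := ciSup_add_ciSup_sub_le (c := c) (φ := fun i => 2 * f i x)
          (u := fun i => 2 * u i x) fun i j => by
            rw [← mul_sub, ← mul_sub, abs_mul, abs_mul]
            exact mul_le_mul_of_nonneg_left (h x i j) (abs_nonneg _)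
        dsimp only at *
        linarith

theorem integrable_sum_eval (μ : Measure α) [IsProbabilityMeasure μ] {f : α → ℝ}
    (hf : Integrable f μ) (n : ℕ) :
    Integrable (fun x : Fin n → α => ∑ k, f (x k)) (Measure.pi fun _ => μ) :=
  integrable_finsetSum _ fun k _ =>
    (measurePreserving_eval (fun _ => μ) k).integrable_comp_of_integrable hf

/-- A comparison of suprema of sums of independent processes, from the comparison of their
terms. -/
theorem integral_ciSup_sum_le (μ : Measure α) [IsProbabilityMeasure μ]
    (ρ : Measure β) [IsProbabilityMeasure ρ] {f : ι → α → ℝ} {v : ι → β → ℝ}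
    (hfm : ∀ i, Measurable (f i)) (hvm : ∀ i, Measurable (v i))
    (hf : ∀ i, Integrable (f i) μ) (hv : ∀ i, Integrable (v i) ρ)
    (h : ∀ c : ι → ℝ, ∫ x, ⨆ i, (c i + f i x) ∂μ ≤ ∫ z, ⨆ i, (c i + v i z) ∂ρ) :
    ∀ (n : ℕ) (c : ι → ℝ),
      ∫ x, ⨆ i, (c i + ∑ k, f i (x k)) ∂(Measure.pi fun _ : Fin n => μ)
        ≤ ∫ z, ⨆ i, (c i + ∑ k, v i (z k)) ∂(Measure.pi fun _ : Fin n => ρ) := by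
  intro n
  induction n with
  | zero => intro c; simp
  | succ n ih =>
    intro c
    have hsf : ∀ n, Integrable (fun x : Fin n → α => ⨆ i, (c i + ∑ k, f i (x k)))
        (Measure.pi fun _ => μ) := fun n =>
      integrable_ciSup fun i => (integrable_const _).add (integrable_sum_eval μ (hf i) n)
    have hsv : ∀ n, Integrable (fun x : Fin n → β => ⨆ i, (c i + ∑ k, v i (x k)))
        (Measure.pi fun _ => ρ) := fun n =>
      integrable_ciSup fun i => (integrable_const _).add (integrable_sum_eval ρ (hv i) n)
    have hmf : Measurable fun x : Fin (n + 1) → α => ⨆ i, (c i + ∑ k, f i (x k)) := by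
      fun_prop
    have hmv : Measurable fun x : Fin (n + 1) → β => ⨆ i, (c i + ∑ k, v i (x k)) := by
      fun_prop
    -- Hybrid process: the first coordinate is already exchanged, the others are not. The arbitrary
    -- shift `c` absorbs whichever coordinates are being held fixed.
    have hmix : Integrable (fun p : β × (Fin n → α) =>
        ⨆ i, (c i + (v i p.1 + ∑ k, f i (p.2 k)))) (ρ.prod (Measure.pi fun _ => μ)) :=
      integrable_ciSup fun i => (integrable_const _).add
        (((hv i).comp_fst _).add ((integrable_sum_eval μ (hf i) n).comp_snd _))
    have hff := (integrable_pi_succ_iff μ hmf).1 (hsf (n + 1))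
    have hvv := (integrable_pi_succ_iff ρ hmv).1 (hsv (n + 1))
    rw [integral_pi_succ μ hmf (hsf _), integral_pi_succ ρ hmv (hsv _)]
    simp only [Fin.sum_univ_succ, Fin.cons_zero, Fin.cons_succ] at hff hvv ⊢
    calc _ ≤ ∫ x' : Fin n → α, ∫ z, ⨆ i, (c i + (v i z + ∑ k, f i (x' k))) ∂ρ
            ∂(Measure.pi fun _ => μ) := by
          refine integral_mono hff.integral_prod_right hmix.integral_prod_right fun x' => ?_
          have := h fun i => c i + ∑ k, f i (x' k)
          simpa only [add_assoc, add_comm, add_left_comm] using this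
      _ = ∫ z, ∫ x' : Fin n → α, ⨆ i, (c i + (v i z + ∑ k, f i (x' k)))
            ∂(Measure.pi fun _ => μ) ∂ρ := (integral_integral_swap hmix).symm
      _ ≤ ∫ z, ∫ z' : Fin n → β, ⨆ i, (c i + (v i z + ∑ k, v i (z' k)))
            ∂(Measure.pi fun _ => ρ) ∂ρ := by
          refine integral_mono hmix.integral_prod_left hvv.integral_prod_left fun z => ?_
          have := ih fun i => c i + v i z
          simpa only [add_assoc] using this
      _ = _ := integral_integral_swap hvv

end Symmetrization

/-! ### Random signs and second moments of sums -/

section SignedSums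

variable {α : Type*} [MeasurableSpace α]

/-- The law of a pair of an independent sample from `μ` and a uniform sign, as `true` or `false`. -/
noncomputable def signedLaw (μ : Measure α) : Measure (α × Bool) :=
  μ.prod (PMF.uniformOfFintype Bool).toMeasure

instance (μ : Measure α) [IsProbabilityMeasure μ] : IsProbabilityMeasure (signedLaw μ) := by
  unfold signedLaw; infer_instance

theorem integral_signedLaw (μ : Measure α) [IsProbabilityMeasure μ] {F : α × Bool → ℝ}
    (hF : Integrable F (signedLaw μ)) :
    ∫ z, F z ∂(signedLaw μ) = ∫ x, (F (x, true) + F (x, false)) / 2 ∂μ := by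
  rw [signedLaw, integral_prod _ hF]
  refine integral_congr_ae (Eventually.of_forall fun x => ?_)
  simp only [PMF.integral_eq_sum, PMF.uniformOfFintype_apply, Fintype.sum_bool, smul_eq_mul]
  simp
  ring

/-- The sign `1` or `-1` coded by a Boolean. -/
def boolSign (s : Bool) : ℝ := if s then 1 else -1

theorem integrable_boolSign_mul {μ : Measure α} [IsProbabilityMeasure μ] {u : α → ℝ}
    (hu : Integrable u μ) (hum : Measurable u) :
    Integrable (fun z : α × Bool => boolSign z.2 * u z.1) (signedLaw μ) := by
  refine (hu.comp_fst (PMF.uniformOfFintype Bool).toMeasure).mono ?_ (Eventually.of_forall ?_)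
  · have : Measurable boolSign := measurable_of_countable _
    exact Measurable.aestronglyMeasurable (by fun_prop)
  · rintro ⟨x, s⟩
    cases s <;> simp [boolSign]

theorem integral_const_add {μ : Measure α} [IsProbabilityMeasure μ] {f : α → ℝ}
    (hf : Integrable f μ) (c : ℝ) : ∫ x, (c + f x) ∂μ = c + ∫ x, f x ∂μ := by
  rw [integral_add (integrable_const _) hf]
  simp

/-- Second moment of a sum of i.i.d. centered variables, shifted by a constant. -/
theorem integral_add_sum_sq (ρ : Measure α) [IsProbabilityMeasure ρ] {ξ : α → ℝ}
    (hm : Measurable ξ) (h2 : MemLp ξ 2 ρ) (h0 : ∫ z, ξ z ∂ρ = 0) : ∀ (n : ℕ) (c : ℝ),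
      ∫ z, (c + ∑ k, ξ (z k)) ^ 2 ∂(Measure.pi fun _ : Fin n => ρ)
        = c ^ 2 + n * ∫ z, ξ z ^ 2 ∂ρ := by
  have hint : ∀ (n : ℕ) (c : ℝ), MemLp (fun z : Fin n → α => c + ∑ k, ξ (z k)) 2
      (Measure.pi fun _ => ρ) := fun n c => (memLp_const c).add
    (memLp_finsetSum _ fun k _ => h2.comp_measurePreserving (measurePreserving_eval _ k))
  intro n
  induction n with
  | zero => intro c; simp
  | succ n ih =>
    intro c
    have hmF : Measurable fun z : Fin (n + 1) → α => (c + ∑ k, ξ (z k)) ^ 2 := by fun_prop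
    have hI := (hint (n + 1) c).integrable_sq
    have hI' := (integrable_pi_succ_iff ρ hmF).1 hI
    rw [integral_pi_succ ρ hmF hI]
    simp only [Fin.sum_univ_succ, Fin.cons_zero, Fin.cons_succ] at hI' ⊢
    have h1 : Integrable ξ ρ := h2.integrable (by norm_num)
    rw [← integral_integral_swap hI']
    have : ∀ x, ∫ y : Fin n → α, (c + (ξ x + ∑ k, ξ (y k))) ^ 2 ∂(Measure.pi fun _ => ρ)
        = (c ^ 2 + n * ∫ z, ξ z ^ 2 ∂ρ) + (2 * c * ξ x + ξ x ^ 2) := by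
      intro x
      simp only [← add_assoc]
      rw [ih]
      ring
    simp only [this]
    have h3 : ∫ x, (2 * c * ξ x + ξ x ^ 2) ∂ρ = ∫ z, ξ z ^ 2 ∂ρ := by
      rw [integral_add (h1.const_mul _) h2.integrable_sq, integral_const_mul, h0]
      simp
    rw [integral_const_add (f := fun x => 2 * c * ξ x + ξ x ^ 2) ((h1.const_mul _).add h2.integrable_sq), h3]
    push_cast
    ring

end SignedSums

/-! ### Uniform deviation bounds for linear predictors -/

section UniformDeviation

variable {ι α : Type*} [MeasurableSpace α] {m : ℕ}

/-- Expected uniform deviation of Lipschitz losses of linear predictors with weights in a ball. -/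
theorem integral_ciSup_deviation_le [Finite ι] [Nonempty ι] (μ : Measure α) [IsProbabilityMeasure μ]
    {f : ι → α → ℝ} {h : α → Fin m → ℝ} {q : ι → Fin m → ℝ} (hfm : ∀ i, Measurable (f i))
    (hf : ∀ i, Integrable (f i) μ) (hhm : ∀ j, Measurable fun x => h x j)
    (h2 : ∀ j, MemLp (fun x => h x j) 2 μ)
    (hlip : ∀ x i j, |f i x - f j x| ≤ |h x ⬝ᵥ q i - h x ⬝ᵥ q j|) {B R θ : ℝ} (hθ : 0 < θ)
    (hq : ∀ i, q i ⬝ᵥ q i ≤ B) (hR : ∑ j, ∫ x, h x j ^ 2 ∂μ ≤ R) (n : ℕ) :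
    ∫ x, ⨆ i, ∑ k, (∫ y, f i y ∂μ - f i (x k)) ∂(Measure.pi fun _ : Fin n => μ)
      ≤ θ * (n * R) + B / θ := by
  have h1 : ∀ j, Integrable (fun x => h x j) μ := fun j => (h2 j).integrable (by norm_num)
  have hum : ∀ i, Measurable fun x => h x ⬝ᵥ q i := fun i => by
    unfold dotProduct
    fun_prop
  have hu : ∀ i, Integrable (fun x => h x ⬝ᵥ q i) μ := fun i =>
    integrable_finsetSum _ fun j _ => (h1 j).mul_const _
  have hsm : Measurable boolSign := measurable_of_countable _
  -- The contraction step has removed the loss, leaving a signed process linear in the weights; the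
  -- factor `2` comes from symmetrization.
  set v : ι → α × Bool → ℝ := fun i z => 2 * (boolSign z.2 * (h z.1 ⬝ᵥ q i)) with hv
  have hvm : ∀ i, Measurable (v i) := fun i => by
    have := hum i
    simp only [hv]
    fun_prop
  have hvi : ∀ i, Integrable (v i) (signedLaw μ) := fun i =>
    (integrable_boolSign_mul (hu i) (hum i)).const_mul 2
  have hstep : ∀ c : ι → ℝ, ∫ x, ⨆ i, (c i + (∫ y, f i y ∂μ - f i x)) ∂μ
      ≤ ∫ z, ⨆ i, (c i + v i z) ∂(signedLaw μ) := by
    intro c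
    refine (integral_ciSup_add_integral_sub_le μ hf hu hlip c).trans (le_of_eq ?_)
    have hci : Integrable (fun z => ⨆ i, (c i + v i z)) (signedLaw μ) :=
      integrable_ciSup fun i => (integrable_const _).add (hvi i)
    rw [integral_signedLaw μ hci]
    simp [hv, boolSign, sub_eq_add_neg]
  have hcmp := integral_ciSup_sum_le μ (signedLaw μ)
    (f := fun i x => ∫ y, f i y ∂μ - f i x) (fun i => (hfm i).const_sub _) hvm
    (fun i => (integrable_const _).sub (hf i)) hvi hstep n fun _ => 0
  simp only [zero_add] at hcmp
  refine hcmp.trans ?_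
  set ξ : Fin m → α × Bool → ℝ := fun j z => boolSign z.2 * h z.1 j with hξ
  have hξm : ∀ j, Measurable (ξ j) := fun j => by
    have := hhm j
    simp only [hξ]
    fun_prop
  have hξsq : ∀ j z, ξ j z ^ 2 = h z.1 j ^ 2 := by
    rintro j ⟨x, s⟩
    cases s <;> simp [hξ, boolSign]
  have hξ2 : ∀ j, MemLp (ξ j) 2 (signedLaw μ) := fun j => by
    rw [memLp_two_iff_integrable_sq (hξm j).aestronglyMeasurable]
    simp only [hξsq]
    exact (h2 j).integrable_sq.comp_fst _
  have hξ0 : ∀ j, ∫ z, ξ j z ∂(signedLaw μ) = 0 := fun j => by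
    rw [integral_signedLaw μ ((hξ2 j).integrable (by norm_num))]
    simp [hξ, boolSign]
  have hξI : ∀ j, ∫ z, ξ j z ^ 2 ∂(signedLaw μ) = ∫ x, h x j ^ 2 ∂μ := fun j => by
    have := (hξ2 j).integrable_sq
    rw [integral_signedLaw μ this]
    simp [hξsq]
  have hY : ∀ j, Integrable (fun z : Fin n → α × Bool => (∑ k, ξ j (z k)) ^ 2)
      (Measure.pi fun _ => signedLaw μ) := fun j =>
    (memLp_finsetSum (f := fun k (z : Fin n → α × Bool) => ξ j (z k)) _ fun k _ =>
      (hξ2 j).comp_measurePreserving (measurePreserving_eval _ k)).integrable_sq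
  have hYI : ∀ j, ∫ z : Fin n → α × Bool, (∑ k, ξ j (z k)) ^ 2 ∂(Measure.pi fun _ => signedLaw μ)
      = n * ∫ x, h x j ^ 2 ∂μ := fun j => by
    have := integral_add_sum_sq (signedLaw μ) (hξm j) (hξ2 j) (hξ0 j) n 0
    simpa [hξI] using this
  have hpt : ∀ z : Fin n → α × Bool, ⨆ i, ∑ k, v i (z k)
      ≤ B / θ + θ * ∑ j, (∑ k, ξ j (z k)) ^ 2 := by
    intro z
    refine ciSup_le fun i => ?_
    have e1 : ∑ k, v i (z k) = ∑ j, 2 * (q i j * ∑ k, ξ j (z k)) := by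
      simp only [hv, hξ, dotProduct, Finset.mul_sum]
      rw [Finset.sum_comm]
      refine Finset.sum_congr rfl fun j _ => Finset.sum_congr rfl fun k _ => by ring
    -- Weighted AM-GM in place of Cauchy–Schwarz: the bound becomes linear in the squared sums,
    -- whose expectations are known exactly, and `θ` is optimized later.
    have e2 : ∀ j, 2 * (q i j * ∑ k, ξ j (z k))
        ≤ q i j * q i j / θ + θ * (∑ k, ξ j (z k)) ^ 2 := by
      intro j
      set y := ∑ k, ξ j (z k)
      have : 0 ≤ (q i j - θ * y) ^ 2 / θ := by positivity
      have e : (q i j - θ * y) ^ 2 / θ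
          = q i j * q i j / θ + θ * y ^ 2 - 2 * (q i j * y) := by
        field_simp
        ring
      linarith
    rw [e1]
    calc _ ≤ ∑ j, (q i j * q i j / θ + θ * (∑ k, ξ j (z k)) ^ 2) :=
          Finset.sum_le_sum fun j _ => e2 j
      _ = (q i ⬝ᵥ q i) / θ + θ * ∑ j, (∑ k, ξ j (z k)) ^ 2 := by
          rw [Finset.sum_add_distrib, Finset.mul_sum, dotProduct, Finset.sum_div]
      _ ≤ _ := by
          gcongr
          exact hq i
  have hYs : Integrable (fun z : Fin n → α × Bool => θ * ∑ j, (∑ k, ξ j (z k)) ^ 2)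
      (Measure.pi fun _ => signedLaw μ) :=
    (integrable_finsetSum Finset.univ fun j _ => hY j).const_mul θ
  have hYs' : ∫ z : Fin n → α × Bool, ∑ j, (∑ k, ξ j (z k)) ^ 2
      ∂(Measure.pi fun _ => signedLaw μ) = n * ∑ j, ∫ x, h x j ^ 2 ∂μ := by
    rw [integral_finsetSum (f := fun j (z : Fin n → α × Bool) => (∑ k, ξ j (z k)) ^ 2)
      Finset.univ fun j _ => hY j, Finset.mul_sum]
    exact Finset.sum_congr rfl fun j _ => hYI j
  clear_value ξ v
  have hvs : Integrable (fun z : Fin n → α × Bool => ⨆ i, ∑ k, v i (z k))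
      (Measure.pi fun _ => signedLaw μ) :=
    integrable_ciSup fun i => integrable_sum_eval _ (hvi i) n
  calc _ ≤ ∫ z : Fin n → α × Bool, (B / θ + θ * ∑ j, (∑ k, ξ j (z k)) ^ 2)
        ∂(Measure.pi fun _ => signedLaw μ) := by
        refine integral_mono hvs ((integrable_const _).add hYs) hpt
    _ = B / θ + θ * (n * ∑ j, ∫ x, h x j ^ 2 ∂μ) := by
        rw [integral_const_add hYs, integral_const_mul, hYs']
    _ ≤ _ := by
        rw [add_comm]
        gcongr

/-- High-probability bound for the uniform deviation over finitely many weight vectors. -/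
theorem measureReal_ciSup_deviation_le [Finite ι] [Nonempty ι] (μ : Measure α)
    [IsProbabilityMeasure μ]
    {f : ι → α → ℝ} {h : α → Fin m → ℝ} {q : ι → Fin m → ℝ} (hfm : ∀ i, Measurable (f i))
    {b : ℝ} (hb : 0 < b) (hf0 : ∀ i x, 0 ≤ f i x) (hfb : ∀ i x, f i x ≤ b)
    (hhm : ∀ j, Measurable fun x => h x j)
    (h2 : ∀ j, MemLp (fun x => h x j) 2 μ)
    (hlip : ∀ x i j, |f i x - f j x| ≤ |h x ⬝ᵥ q i - h x ⬝ᵥ q j|) {B R θ s : ℝ} (hθ : 0 < θ)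
    (hs : 0 < s)
    (hq : ∀ i, q i ⬝ᵥ q i ≤ B) (hR : ∑ j, ∫ x, h x j ^ 2 ∂μ ≤ R) {n : ℕ} (hn : 0 < n) :
    (Measure.pi fun _ : Fin n => μ).real
        {x | θ * (n * R) + B / θ + s ≤ ⨆ i, ∑ k, (∫ y, f i y ∂μ - f i (x k))}
      ≤ Real.exp (-(2 * s ^ 2 / (n * b ^ 2))) := by
  have hf : ∀ i, Integrable (f i) μ := fun i => integrable_of_abs_le (hfm i) (K := b) fun x => by
    rw [abs_of_nonneg (hf0 i x)]
    exact hfb i x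
  have hE := integral_ciSup_deviation_le μ hfm hf hhm h2 hlip hθ hq hR n
  set F : (Fin n → α) → ℝ := fun x => ⨆ i, ∑ k, (∫ y, f i y ∂μ - f i (x k)) with hF
  have hFm : Measurable F := by fun_prop
  have hbd : ∀ w : ι → ℝ, BddAbove (Set.range w) := fun w => (Set.finite_range w).bddAbove
  have hI0 : ∀ i, 0 ≤ ∫ y, f i y ∂μ := fun i => integral_nonneg (hf0 i)
  have hIb : ∀ i, ∫ y, f i y ∂μ ≤ b := fun i => by
    have := integral_mono (hf i) (integrable_const b) (hfb i)
    simpa using this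
  have hK : ∀ x, |F x| ≤ n * b := by
    intro x
    have ht : ∀ i, |∑ k, (∫ y, f i y ∂μ - f i (x k))| ≤ n * b := by
      intro i
      refine (Finset.abs_sum_le_sum_abs _ _).trans ?_
      have : ∀ k ∈ Finset.univ, |∫ y, f i y ∂μ - f i (x k)| ≤ b := fun k _ => by
        rw [abs_le]
        constructor <;> linarith [hI0 i, hIb i, hf0 i (x k), hfb i (x k)]
      simpa using Finset.sum_le_card_nsmul _ _ _ this
    obtain ⟨i, hi⟩ := exists_eq_ciSup_of_finite (f := fun i => ∑ k, (∫ y, f i y ∂μ - f i (x k)))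
    simp only [hF]
    rw [← hi]
    exact ht i
  have hd : ∀ x i z z', F (Function.update x i z) - F (Function.update x i z') ≤ b := by
    intro x l z z'
    rw [sub_le_iff_le_add]
    refine ciSup_le fun i => ?_
    have h3 := le_ciSup (hbd fun i => ∑ k, (∫ y, f i y ∂μ - f i (Function.update x l z' k))) i
    have h4 : ∀ w, ∑ k, (∫ y, f i y ∂μ - f i (Function.update x l w k))
        = (∫ y, f i y ∂μ - f i w) + ∑ k ∈ Finset.univ.erase l, (∫ y, f i y ∂μ - f i (x k)) := by
      intro w
      rw [← Finset.add_sum_erase _ _ (Finset.mem_univ l)]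
      simp only [Function.update_self]
      congr 1
      refine Finset.sum_congr rfl fun k hk => ?_
      rw [Function.update_of_ne (Finset.ne_of_mem_erase hk)]
    have h5 : F (Function.update x l z') = ⨆ i, ∑ k, (∫ y, f i y ∂μ
      - f i (Function.update x l z' k)) := rfl
    rw [← h5, h4] at h3
    rw [h4]
    linarith [hf0 i z, hfb i z']
  refine le_trans (measureReal_mono ?_) (measureReal_ge_le_of_bounded_differences μ hb hs hn hFm
    ⟨_, hK⟩ hd)
  intro x hx
  simp only [Set.mem_ofPred_eq] at hx ⊢
  linarith

/-- High-probability bound for the uniform deviation over a sequence of weight vectors. -/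
theorem measure_exists_deviation_le (μ : Measure α)
    [IsProbabilityMeasure μ]
    {f : ℕ → α → ℝ} {h : α → Fin m → ℝ} {q : ℕ → Fin m → ℝ} (hfm : ∀ i, Measurable (f i))
    {b : ℝ} (hb : 0 < b) (hf0 : ∀ i x, 0 ≤ f i x) (hfb : ∀ i x, f i x ≤ b)
    (hhm : ∀ j, Measurable fun x => h x j)
    (h2 : ∀ j, MemLp (fun x => h x j) 2 μ)
    (hlip : ∀ x i j, |f i x - f j x| ≤ |h x ⬝ᵥ q i - h x ⬝ᵥ q j|) {B R θ s : ℝ} (hθ : 0 < θ)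
    (hs : 0 < s)
    (hq : ∀ i, q i ⬝ᵥ q i ≤ B) (hR : ∑ j, ∫ x, h x j ^ 2 ∂μ ≤ R) {n : ℕ} (hn : 0 < n) :
    (Measure.pi fun _ : Fin n => μ)
        {x | ∃ i, θ * (n * R) + B / θ + s < ∑ k, (∫ y, f i y ∂μ - f i (x k))}
      ≤ ENNReal.ofReal (Real.exp (-(2 * s ^ 2 / (n * b ^ 2)))) := by
  -- The tail bound does not depend on the number of weight vectors, so continuity from below
  -- extends it to a whole sequence.
  set S : ℕ → Set (Fin n → α) := fun N =>
    {x | ∃ i ≤ N, θ * (n * R) + B / θ + s < ∑ k, (∫ y, f i y ∂μ - f i (x k))} with hS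
  have hU : {x : Fin n → α | ∃ i, θ * (n * R) + B / θ + s < ∑ k, (∫ y, f i y ∂μ - f i (x k))}
      = ⋃ N, S N := by
    ext x
    simp only [hS, Set.mem_ofPred_eq, Set.mem_iUnion]
    exact ⟨fun ⟨i, hi⟩ => ⟨i, i, le_rfl, hi⟩, fun ⟨_, i, _, hi⟩ => ⟨i, hi⟩⟩
  have hmono : Monotone S := fun N N' hN x ⟨i, hi, hx⟩ => ⟨i, hi.trans hN, hx⟩
  rw [hU, hmono.measure_iUnion]
  refine iSup_le fun N => ?_
  have := measureReal_ciSup_deviation_le (ι := Fin (N + 1)) μ (f := fun i => f i)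
    (q := fun i => q i) (fun i => hfm i) hb (fun i => hf0 i) (fun i => hfb i) hhm h2
    (fun x i j => hlip x i j) hθ hs (fun i => hq i) hR hn
  rw [ENNReal.le_ofReal_iff_toReal_le (measure_ne_top _ _) (Real.exp_pos _).le]
  refine le_trans (measureReal_mono ?_) this
  rintro x ⟨i, hi, hx⟩
  refine hx.le.trans ?_
  exact le_ciSup (f := fun i : Fin (N + 1) => ∑ k, (∫ y, f i y ∂μ - f i (x k)))
    (Set.finite_range _).bddAbove ⟨i, Nat.lt_succ_of_le hi⟩

end UniformDeviation

/-! ### SGD for an interpolable least-squares problem -/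

section StochasticGradient

variable {n m : ℕ}

theorem dotProduct_sub_smul_self (v w : Fin m → ℝ) (c : ℝ) :
    (v - c • w) ⬝ᵥ (v - c • w) = v ⬝ᵥ v - 2 * c * (w ⬝ᵥ v) + c ^ 2 * (w ⬝ᵥ w) := by
  simp only [sub_dotProduct, dotProduct_sub, smul_dotProduct, dotProduct_smul, smul_eq_mul]
  rw [dotProduct_comm v w]
  ring

theorem dotProduct_self_nonneg_real (v : Fin m → ℝ) : 0 ≤ v ⬝ᵥ v :=
  Finset.sum_nonneg fun i _ => mul_self_nonneg (v i)

theorem dotProduct_sq_le (v w : Fin m → ℝ) : (v ⬝ᵥ w) ^ 2 ≤ (v ⬝ᵥ v) * (w ⬝ᵥ w) := by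
  simpa only [dotProduct, sq] using Finset.sum_mul_sq_le_sq_mul_sq Finset.univ v w

/-- Because `s` fits every label, the residual at `a` depends only on the error `a - s`: there is no
gradient noise at the solution. -/
theorem sgdStep_sub_of_lt {η : ℝ} {h : Matrix (Fin n) (Fin m) ℝ} {y : Fin n → ℝ} {s : Fin m → ℝ}
    (hs : ∀ i, h i ⬝ᵥ s = y i) (a : Fin m → ℝ) (i : Fin n) :
    sgdStep η h y a i - s = (a - s) - (η * (h i ⬝ᵥ (a - s))) • h i := by
  simp only [sgdStep, i.isLt, dite_true, Fin.eta, dotProduct_sub, hs]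
  abel

/-- Expanding the square gives a gain of `2 * η * r ^ 2` against a loss of `η ^ 2 * r ^ 2 * (h i ⬝ᵥ
h i)`, with `r` the residual; the step-size condition lets the loss eat at most half of the gain. -/
theorem sgdStep_sub_dotProduct_self_le {η : ℝ} (hη : 0 < η) {h : Matrix (Fin n) (Fin m) ℝ}
    {y : Fin n → ℝ} {s : Fin m → ℝ} (hs : ∀ i, h i ⬝ᵥ s = y i) (hh : ∀ i, η * (h i ⬝ᵥ h i) ≤ 1)
    (a : Fin m → ℝ) (i : Fin n) :
    (sgdStep η h y a i - s) ⬝ᵥ (sgdStep η h y a i - s)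
      ≤ (a - s) ⬝ᵥ (a - s) - η * (h i ⬝ᵥ (a - s)) ^ 2 := by
  rw [sgdStep_sub_of_lt hs, dotProduct_sub_smul_self]
  set r := h i ⬝ᵥ (a - s)
  have : η * r ^ 2 * (η * (h i ⬝ᵥ h i)) ≤ η * r ^ 2 * 1 :=
    mul_le_mul_of_nonneg_left (hh i) (by positivity)
  nlinarith

theorem foldl_sgdStep_sub_dotProduct_self_le {η : ℝ} (hη : 0 < η) {h : Matrix (Fin n) (Fin m) ℝ}
    {y : Fin n → ℝ} {s : Fin m → ℝ} (hs : ∀ i, h i ⬝ᵥ s = y i) (hh : ∀ i, η * (h i ⬝ᵥ h i) ≤ 1) :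
    ∀ (T : ℕ) (e : Fin T → ℕ) (a : Fin m → ℝ),
      (Fin.foldl T (fun a t => sgdStep η h y a (e t)) a - s) ⬝ᵥ
        (Fin.foldl T (fun a t => sgdStep η h y a (e t)) a - s) ≤ (a - s) ⬝ᵥ (a - s) := by
  intro T
  induction T with
  | zero => intro e a; simp
  | succ T ih =>
    intro e a
    rw [Fin.foldl_succ]
    refine (ih (fun t => e t.succ) _).trans ?_
    by_cases hk : e 0 < n
    · refine (sgdStep_sub_dotProduct_self_le hη hs hh a ⟨e 0, hk⟩).trans ?_
      have : 0 ≤ η * (h ⟨e 0, hk⟩ ⬝ᵥ (a - s)) ^ 2 := by positivity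
      linarith
    · simp [sgdStep, hk]

theorem sgdWeights_dotProduct_self_le {η : ℝ} (hη : 0 < η) {h : Matrix (Fin n) (Fin m) ℝ}
    {y : Fin n → ℝ} {s : Fin m → ℝ} (hs : ∀ i, h i ⬝ᵥ s = y i) (hh : ∀ i, η * (h i ⬝ᵥ h i) ≤ 1)
    (T : ℕ) (e : Fin T → ℕ) :
    sgdWeights η h y T e ⬝ᵥ sgdWeights η h y T e ≤ 4 * (s ⬝ᵥ s) := by
  have h1 := foldl_sgdStep_sub_dotProduct_self_le hη hs hh T e 0
  change (sgdWeights η h y T e - s) ⬝ᵥ (sgdWeights η h y T e - s) ≤ _ at h1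
  set a := sgdWeights η h y T e
  -- From `|a - s| ≤ |s|` one gets `a ⬝ᵥ a ≤ 2 * (s ⬝ᵥ a)`, and this square bounds `s ⬝ᵥ a`; no
  -- square roots are needed.
  have h2 := dotProduct_self_nonneg_real (a - (2 : ℝ) • s)
  have h3 := dotProduct_sub_smul_self a s 1
  rw [dotProduct_sub_smul_self] at h2
  rw [one_smul] at h3
  simp only [zero_sub, neg_dotProduct_neg] at h1
  linarith

/-- On the span of the rows of a matrix, the quadratic form `∑ i, (h i ⬝ᵥ v) ^ 2` is coercive. -/
theorem exists_pos_mul_dotProduct_self_le (h : Matrix (Fin n) (Fin m) ℝ) :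
    ∃ c : ℝ, 0 < c ∧ ∀ v ∈ Submodule.span ℝ (Set.range h.row),
      c * (v ⬝ᵥ v) ≤ ∑ i, (h i ⬝ᵥ v) ^ 2 := by
  set V := Submodule.span ℝ (Set.range h.row) with hV
  -- A vector in the row span that is orthogonal to all rows is orthogonal to itself.
  have hker : LinearMap.ker (h.mulVecLin.domRestrict V) = ⊥ := by
    rw [LinearMap.ker_eq_bot']
    rintro ⟨v, hv⟩ hv0
    have hz : ∀ i, h i ⬝ᵥ v = 0 := fun i => congrFun hv0 i
    have : ∀ w ∈ V, w ⬝ᵥ v = 0 := by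
      intro w hw
      induction hw using Submodule.span_induction with
      | mem x hx => obtain ⟨i, rfl⟩ := hx; exact hz i
      | zero => simp
      | add x y _ _ hx hy => rw [add_dotProduct, hx, hy, add_zero]
      | smul a x _ hx => rw [smul_dotProduct, hx, smul_zero]
    exact Subtype.ext (dotProduct_self_eq_zero.1 (this v hv))
  obtain ⟨K, hK, hKa⟩ := LinearMap.exists_antilipschitzWith _ hker
  have hK' : (0 : ℝ) < K := by exact_mod_cast hK
  -- A factor `m` passes from the sup norm to the dot product; `m + 1` stays positive at width `0`.
  refine ⟨1 / ((m + 1) * (K : ℝ) ^ 2), by positivity, fun v hv => ?_⟩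
  rw [one_div, inv_mul_le_iff₀ (by positivity)]
  have h1 : ‖v‖ ≤ K * ‖h *ᵥ v‖ := by
    have := hKa.le_mul_dist ⟨v, hv⟩ 0
    simpa using this
  have h2 : v ⬝ᵥ v ≤ m * ‖v‖ ^ 2 := by
    have : ∀ j ∈ Finset.univ, v j * v j ≤ ‖v‖ ^ 2 := fun j _ => by
      rw [← sq, ← sq_abs]
      exact pow_le_pow_left₀ (abs_nonneg _) (norm_le_pi_norm v j) 2
    simpa [dotProduct] using Finset.sum_le_card_nsmul _ _ _ this
  have h3 : ‖h *ᵥ v‖ ^ 2 ≤ ∑ i, (h i ⬝ᵥ v) ^ 2 := by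
    have h4 : ‖h *ᵥ v‖ ≤ √(∑ i, (h i ⬝ᵥ v) ^ 2) := by
      refine (pi_norm_le_iff_of_nonneg (Real.sqrt_nonneg _)).2 fun i => ?_
      refine Real.le_sqrt_of_sq_le ?_
      rw [Real.norm_eq_abs, sq_abs]
      exact Finset.single_le_sum (f := fun i => (h i ⬝ᵥ v) ^ 2) (fun _ _ => sq_nonneg _)
        (Finset.mem_univ i)
    calc _ ≤ √(∑ i, (h i ⬝ᵥ v) ^ 2) ^ 2 := pow_le_pow_left₀ (norm_nonneg _) h4 2
      _ = _ := Real.sq_sqrt (Finset.sum_nonneg fun _ _ => sq_nonneg _)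
  calc v ⬝ᵥ v ≤ m * ‖v‖ ^ 2 := h2
    _ ≤ (m + 1) * (K * ‖h *ᵥ v‖) ^ 2 := by gcongr; linarith
    _ = (m + 1) * (K : ℝ) ^ 2 * ‖h *ᵥ v‖ ^ 2 := by ring
    _ ≤ _ := by gcongr

theorem lintegral_exampleLaw (hn : n ≠ 0) (F : ℕ → ℝ) (hF : ∀ k, 0 ≤ F k) :
    ∫⁻ k, ENNReal.ofReal (F k) ∂(exampleLaw n).toMeasure
      = ENNReal.ofReal ((∑ i : Fin n, F i) / n) := by
  have hn' : (0 : ℝ) < n := by positivity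
  rw [lintegral_countable']
  simp only [PMF.toMeasure_apply_singleton _ _ (measurableSet_singleton _), exampleLaw, hn,
    dite_false, PMF.uniformOfFinset_apply]
  rw [tsum_eq_sum (s := Finset.range n) (by
    intro k hk
    simp [hk])]
  rw [div_eq_mul_inv, ENNReal.ofReal_mul' (by positivity), ENNReal.ofReal_inv_of_pos hn',
    ENNReal.ofReal_natCast, ENNReal.ofReal_sum_of_nonneg (f := fun i : Fin n => F i)
      (fun i _ => hF i), Finset.sum_mul,
    Finset.sum_range fun k => ENNReal.ofReal (F k) * _]
  refine Finset.sum_congr rfl fun i _ => ?_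
  simp

/-- SGD from a point that differs from an interpolating weight vector by an element of the span of
the rows converges to it geometrically in mean square. -/
theorem exists_lintegral_foldl_sgdStep_le (hn : n ≠ 0) {η : ℝ} (hη : 0 < η)
    {h : Matrix (Fin n) (Fin m) ℝ}
    {y : Fin n → ℝ} {s : Fin m → ℝ} (hs : ∀ i, h i ⬝ᵥ s = y i) (hh : ∀ i, η * (h i ⬝ᵥ h i) ≤ 1) :
    ∃ r : ℝ, 0 ≤ r ∧ r < 1 ∧ ∀ (T : ℕ) (a : Fin m → ℝ),
      a - s ∈ Submodule.span ℝ (Set.range h.row) →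
      ∫⁻ e, ENNReal.ofReal ((Fin.foldl T (fun a t => sgdStep η h y a (e t)) a - s) ⬝ᵥ
        (Fin.foldl T (fun a t => sgdStep η h y a (e t)) a - s))
        ∂(Measure.pi fun _ : Fin T => (exampleLaw n).toMeasure)
      ≤ ENNReal.ofReal (r ^ T * ((a - s) ⬝ᵥ (a - s))) := by
  obtain ⟨c, hc, hcV⟩ := exists_pos_mul_dotProduct_self_le h
  have hn' : (0 : ℝ) < n := by positivity
  -- The coercivity constant `c` is not sharp (for a trivial span it is arbitrary), so the
  -- contraction factor is cut off at `0`.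
  set r : ℝ := max 0 (1 - η * c / n) with hr
  have hr0 : 0 ≤ r := le_max_left _ _
  refine ⟨r, hr0, max_lt one_pos (by linarith [show 0 < η * c / n by positivity]), ?_⟩
  intro T
  induction T with
  | zero => intro a _; simp
  | succ T ih =>
    intro a ha
    rw [lintegral_pi_succ _ (measurable_of_countable _)]
    simp only [Fin.foldl_succ, Fin.cons_zero, Fin.cons_succ]
    -- Each step moves along a row, so the error never leaves the subspace where coercivity holds.
    have hmem : ∀ k, sgdStep η h y a k - s ∈ Submodule.span ℝ (Set.range h.row) := by
      intro k
      by_cases hk : k < n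
      · have := sgdStep_sub_of_lt (η := η) hs a ⟨k, hk⟩
        simp only at this
        rw [this]
        exact Submodule.sub_mem _ ha (Submodule.smul_mem _ _ (Submodule.subset_span ⟨_, rfl⟩))
      · simpa [sgdStep, hk] using ha
    refine (lintegral_mono fun k => ih _ (hmem k)).trans ?_
    rw [lintegral_exampleLaw hn _ fun k => mul_nonneg (pow_nonneg hr0 _)
      (dotProduct_self_nonneg_real _)]
    refine ENNReal.ofReal_le_ofReal ?_
    rw [← Finset.mul_sum, pow_succ, mul_div_assoc, mul_assoc]
    refine mul_le_mul_of_nonneg_left ?_ (pow_nonneg hr0 _)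
    rw [div_le_iff₀ hn']
    have h1 : ∑ i : Fin n, (sgdStep η h y a i - s) ⬝ᵥ (sgdStep η h y a i - s)
        ≤ ∑ i : Fin n, ((a - s) ⬝ᵥ (a - s) - η * (h i ⬝ᵥ (a - s)) ^ 2) :=
      Finset.sum_le_sum fun i _ => sgdStep_sub_dotProduct_self_le hη hs hh a i
    rw [Finset.sum_sub_distrib, ← Finset.mul_sum] at h1
    simp only [Finset.sum_const, Finset.card_univ, Fintype.card_fin, nsmul_eq_mul] at h1
    have h2 := mul_le_mul_of_nonneg_left (hcV _ ha) hη.le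
    have h3 : (1 - η * c / n) * ((a - s) ⬝ᵥ (a - s)) * n ≤ r * ((a - s) ⬝ᵥ (a - s)) * n := by
      gcongr
      · exact dotProduct_self_nonneg_real _
      · exact le_max_right _ _
    have h4 : (1 - η * c / n) * ((a - s) ⬝ᵥ (a - s)) * n
        = n * ((a - s) ⬝ᵥ (a - s)) - η * (c * ((a - s) ⬝ᵥ (a - s))) := by
      field_simp
    linarith

theorem tendsto_measure_sgdWeights (hn : n ≠ 0) {η : ℝ} (hη : 0 < η)
    {h : Matrix (Fin n) (Fin m) ℝ}
    {y : Fin n → ℝ} {s : Fin m → ℝ} (hs : ∀ i, h i ⬝ᵥ s = y i) (hh : ∀ i, η * (h i ⬝ᵥ h i) ≤ 1)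
    (hsp : s ∈ Submodule.span ℝ (Set.range h.row)) {c : ℝ} (hc : 0 < c) :
    Tendsto (fun T => (Measure.pi fun _ : Fin T => (exampleLaw n).toMeasure)
      {e | c ≤ (sgdWeights η h y T e - s) ⬝ᵥ (sgdWeights η h y T e - s)}) atTop (nhds 0) := by
  obtain ⟨r, hr0, hr1, hr⟩ := exists_lintegral_foldl_sgdStep_le hn hη hs hh
  have hb : ∀ T, (Measure.pi fun _ : Fin T => (exampleLaw n).toMeasure)
      {e | c ≤ (sgdWeights η h y T e - s) ⬝ᵥ (sgdWeights η h y T e - s)}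
      ≤ ENNReal.ofReal (r ^ T * (s ⬝ᵥ s) / c) := by
    intro T
    have h1 := hr T 0 (by simpa using hsp)
    simp only [zero_sub, neg_dotProduct_neg] at h1
    rw [ENNReal.ofReal_div_of_pos hc]
    refine le_trans (measure_mono fun e he => ?_)
      ((meas_ge_le_lintegral_div (μ := Measure.pi fun _ : Fin T => (exampleLaw n).toMeasure)
        (f := fun e => ENNReal.ofReal ((sgdWeights η h y T e - s) ⬝ᵥ (sgdWeights η h y T e - s)))
        (measurable_of_countable _).aemeasurable (ENNReal.ofReal_pos.2 hc).ne'
        ENNReal.ofReal_ne_top).trans (ENNReal.div_le_div_right h1 _))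
    exact ENNReal.ofReal_le_ofReal he
  refine tendsto_of_tendsto_of_tendsto_of_le_of_le tendsto_const_nhds ?_ (fun _ => zero_le) hb
  have h2 : Tendsto (fun T : ℕ => r ^ T * (s ⬝ᵥ s) / c) atTop (nhds 0) := by
    have := ((tendsto_pow_atTop_nhds_zero_of_lt_one hr0 hr1).mul_const (s ⬝ᵥ s)).div_const c
    simpa using this
  simpa using ENNReal.tendsto_ofReal h2

end StochasticGradient

/-! ### Empirical Gram matrices and minimum-norm interpolation -/

section GramMatrix

variable {d n m : ℕ}

theorem measurable_hiddenRow {α : Type*} [MeasurableSpace α] {σ : ℝ → ℝ} (hσ : Measurable σ)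
    {W : α → Fin m → EuclideanSpace ℝ (Fin d)} (hW : Measurable W)
    {x : α → EuclideanSpace ℝ (Fin d)} (hx : Measurable x) (j : Fin m) :
    Measurable fun p => hiddenRow σ m (W p) (x p) j := by
  unfold hiddenRow
  have : Measurable fun p => W p j := (measurable_pi_apply j).comp hW
  fun_prop

theorem hiddenRow_dotProduct (σ : ℝ → ℝ) (W : Fin m → EuclideanSpace ℝ (Fin d))
    (x x' : EuclideanSpace ℝ (Fin d)) :
    hiddenRow σ m W x ⬝ᵥ hiddenRow σ m W x' = (∑ j, σ ⟪W j, x⟫_ℝ * σ ⟪W j, x'⟫_ℝ) / m := by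
  simp only [dotProduct, hiddenRow, div_mul_div_comm, Real.mul_self_sqrt (Nat.cast_nonneg m),
    Finset.sum_div]

/-- Cramer's rule makes the quadratic form rational in the entries of `G`, which yields both its
measurability and its limits. -/
theorem dotProduct_inv_mulVec {k : ℕ} (G : Matrix (Fin k) (Fin k) ℝ) (y : Fin k → ℝ) :
    y ⬝ᵥ (G⁻¹ *ᵥ y) = (G.det)⁻¹ * (y ⬝ᵥ (G.adjugate *ᵥ y)) := by
  rw [Matrix.inv_def, Ring.inverse_eq_inv', Matrix.smul_mulVec, dotProduct_smul, smul_eq_mul]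

/-- The empirical Gram matrix of the hidden layer. -/
noncomputable def hiddenGram (σ : ℝ → ℝ) (m : ℕ) (W : Fin m → EuclideanSpace ℝ (Fin d))
    {k : ℕ} (x : Fin k → EuclideanSpace ℝ (Fin d)) : Matrix (Fin k) (Fin k) ℝ :=
  hiddenMatrix σ m W x * (hiddenMatrix σ m W x)ᵀ

theorem hiddenGram_apply (σ : ℝ → ℝ) (W : Fin m → EuclideanSpace ℝ (Fin d))
    {k : ℕ} (x : Fin k → EuclideanSpace ℝ (Fin d)) (i j : Fin k) :
    hiddenGram σ m W x i j = hiddenRow σ m W (x i) ⬝ᵥ hiddenRow σ m W (x j) := rfl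

theorem measurable_hiddenGram {σ : ℝ → ℝ} (hσ : Measurable σ) {k : ℕ} (f : Fin k → Fin n) :
    Measurable fun p : (Fin n → EuclideanSpace ℝ (Fin d)) × (Fin m → EuclideanSpace ℝ (Fin d)) =>
      fun i j => hiddenGram σ m p.2 (p.1 ∘ f) i j := by
  refine measurable_pi_lambda _ fun i => measurable_pi_lambda _ fun j => ?_
  have h (l : Fin n) (j : Fin m) := measurable_hiddenRow hσ
    (α := (Fin n → EuclideanSpace ℝ (Fin d)) × (Fin m → EuclideanSpace ℝ (Fin d)))
    measurable_snd ((measurable_pi_apply l).comp measurable_fst) j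
  simp only [hiddenGram_apply, dotProduct, Function.comp] at h ⊢
  fun_prop

/-- The hidden layer is well-conditioned: on the sample points its features are bounded and
interpolate `g` with squared norm at most `M`, and its features are bounded in mean square. -/
structure IsGoodDraw (σ : ℝ → ℝ) (D : Measure (EuclideanSpace ℝ (Fin d)))
    (g : EuclideanSpace ℝ (Fin d) → ℝ) (κ M : ℝ) (x : Fin n → EuclideanSpace ℝ (Fin d))
    (W : Fin m → EuclideanSpace ℝ (Fin d)) : Prop where
  norm_le : ∀ i, hiddenRow σ m W (x i) ⬝ᵥ hiddenRow σ m W (x i) ≤ κ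
  gram : ∀ (k : Fin (n + 1)) (f : Fin k → Fin n), Function.Injective (x ∘ f) →
    (hiddenGram σ m W (x ∘ f)).det ≠ 0 ∧
      (fun i => g (x (f i))) ⬝ᵥ ((hiddenGram σ m W (x ∘ f))⁻¹ *ᵥ fun i => g (x (f i))) ≤ M
  lintegral_le : ∫⁻ z, ENNReal.ofReal (hiddenRow σ m W z ⬝ᵥ hiddenRow σ m W z) ∂D
    ≤ ENNReal.ofReal κ

theorem measurableSet_lintegral_hiddenRow_le {σ : ℝ → ℝ} (hσ : Measurable σ)
    (D : Measure (EuclideanSpace ℝ (Fin d))) [IsProbabilityMeasure D] (κ : ℝ) :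
    MeasurableSet {W : Fin m → EuclideanSpace ℝ (Fin d) |
      ∫⁻ z, ENNReal.ofReal (hiddenRow σ m W z ⬝ᵥ hiddenRow σ m W z) ∂D ≤ ENNReal.ofReal κ} := by
  refine measurableSet_le (Measurable.lintegral_prod_right' (f := fun p :
    (Fin m → EuclideanSpace ℝ (Fin d)) × EuclideanSpace ℝ (Fin d) =>
      ENNReal.ofReal (hiddenRow σ m p.1 p.2 ⬝ᵥ hiddenRow σ m p.1 p.2)) ?_) measurable_const
  have h (j : Fin m) := measurable_hiddenRow hσ
    (α := (Fin m → EuclideanSpace ℝ (Fin d)) × EuclideanSpace ℝ (Fin d))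
    measurable_fst measurable_snd j
  simp only [dotProduct]
  fun_prop

theorem measurableSet_isGoodDraw {σ : ℝ → ℝ} (hσ : Measurable σ)
    (D : Measure (EuclideanSpace ℝ (Fin d))) [IsProbabilityMeasure D]
    {g : EuclideanSpace ℝ (Fin d) → ℝ} (hg : Measurable g) (κ M : ℝ) :
    MeasurableSet {p : (Fin n → EuclideanSpace ℝ (Fin d)) × (Fin m → EuclideanSpace ℝ (Fin d)) |
      IsGoodDraw σ D g κ M p.1 p.2} := by
  have hset : {p : (Fin n → EuclideanSpace ℝ (Fin d)) × (Fin m → EuclideanSpace ℝ (Fin d)) |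
      IsGoodDraw σ D g κ M p.1 p.2} =
      (⋂ i, {p : (Fin n → EuclideanSpace ℝ (Fin d)) × (Fin m → EuclideanSpace ℝ (Fin d)) |
        hiddenRow σ m p.2 (p.1 i) ⬝ᵥ hiddenRow σ m p.2 (p.1 i) ≤ κ}) ∩
      (⋂ (k : Fin (n + 1)) (f : Fin k → Fin n),
        {p | Function.Injective (p.1 ∘ f)}ᶜ ∪ ({p | (hiddenGram σ m p.2 (p.1 ∘ f)).det = 0}ᶜ ∩
          {p | (fun i => g (p.1 (f i))) ⬝ᵥ
            ((hiddenGram σ m p.2 (p.1 ∘ f))⁻¹ *ᵥ fun i => g (p.1 (f i))) ≤ M})) ∩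
      Prod.snd ⁻¹' {W | ∫⁻ z, ENNReal.ofReal (hiddenRow σ m W z ⬝ᵥ hiddenRow σ m W z) ∂D
        ≤ ENNReal.ofReal κ} := by
    ext p
    simp only [Set.mem_ofPred_eq, Set.mem_inter_iff, Set.mem_iInter, Set.mem_union,
      Set.mem_compl_iff, Set.mem_preimage, ← imp_iff_not_or]
    exact ⟨fun h => ⟨⟨h.1, h.2⟩, h.3⟩, fun h => ⟨h.1.1, h.1.2, h.2⟩⟩
  rw [hset]
  refine ((MeasurableSet.iInter fun i => ?_).inter (MeasurableSet.iInter fun k =>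
    MeasurableSet.iInter fun f => MeasurableSet.union (MeasurableSet.compl ?_)
      (MeasurableSet.inter (MeasurableSet.compl ?_) ?_))).inter
        (measurable_snd (measurableSet_lintegral_hiddenRow_le hσ D κ))
  · refine measurableSet_le ?_ measurable_const
    have h (j : Fin m) := measurable_hiddenRow hσ
      (α := (Fin n → EuclideanSpace ℝ (Fin d)) × (Fin m → EuclideanSpace ℝ (Fin d)))
      measurable_snd ((measurable_pi_apply i).comp measurable_fst) j
    simp only [dotProduct, Function.comp] at h ⊢
    fun_prop
  · have : {p : (Fin n → EuclideanSpace ℝ (Fin d)) × (Fin m → EuclideanSpace ℝ (Fin d)) |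
        Function.Injective (p.1 ∘ f)} = ⋂ (i) (j), {p | p.1 (f i) = p.1 (f j)}ᶜ ∪ {_p | i = j} := by
      ext p
      simp only [Function.Injective, Function.comp, Set.mem_ofPred_eq, Set.mem_iInter,
        Set.mem_union, Set.mem_compl_iff, ← imp_iff_not_or]
    rw [this]
    refine MeasurableSet.iInter fun i => MeasurableSet.iInter fun j =>
      (MeasurableSet.compl (measurableSet_eq_fun ?_ ?_)).union (MeasurableSet.const _) <;> fun_prop
  · refine measurableSet_eq_fun ?_ measurable_const
    have hc : Continuous fun G : Fin k → Fin k → ℝ => (Matrix.of G).det := by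
      exact Continuous.matrix_det continuous_id
    exact hc.measurable.comp (measurable_hiddenGram hσ f)
  · simp only [dotProduct_inv_mulVec]
    refine measurableSet_le ?_ measurable_const
    have hc : Continuous fun G : Fin k → Fin k → ℝ => (Matrix.of G).det := by
      exact Continuous.matrix_det continuous_id
    have hc2 : Continuous fun p : (Fin k → ℝ) × (Fin k → Fin k → ℝ) =>
        p.1 ⬝ᵥ ((Matrix.of p.2).adjugate *ᵥ p.1) := by
      refine Continuous.dotProduct continuous_fst (Continuous.matrix_mulVec ?_ continuous_fst)
      exact Continuous.matrix_adjugate continuous_snd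
    have hy : Measurable fun p : (Fin n → EuclideanSpace ℝ (Fin d)) ×
        (Fin m → EuclideanSpace ℝ (Fin d)) => fun i : Fin k => g (p.1 (f i)) := by fun_prop
    exact (hc.measurable.comp (measurable_hiddenGram hσ f)).inv.mul
      (hc2.measurable.comp (hy.prodMk (measurable_hiddenGram hσ f)))

/-- The distribution may have atoms, so the sample may repeat points and its full Gram matrix may be
singular. One index is kept for each distinct point; repeated points carry equal labels, so
interpolating the reduced sample suffices. For it `s = hᵀ G⁻¹ y` has squared norm exactly `y ⬝ᵥ G⁻¹
*ᵥ y`. -/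
theorem IsGoodDraw.exists_interpolation {σ : ℝ → ℝ} {D : Measure (EuclideanSpace ℝ (Fin d))}
    {g : EuclideanSpace ℝ (Fin d) → ℝ} {κ M : ℝ} {x : Fin n → EuclideanSpace ℝ (Fin d)}
    {W : Fin m → EuclideanSpace ℝ (Fin d)} (hG : IsGoodDraw σ D g κ M x W) :
    ∃ s : Fin m → ℝ, (∀ i, hiddenMatrix σ m W x i ⬝ᵥ s = g (x i)) ∧ s ⬝ᵥ s ≤ M ∧
      s ∈ Submodule.span ℝ (Set.range (hiddenMatrix σ m W x).row) := by
  classical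
  set k := Fintype.card (Set.range x) with hk
  have hkn : k < n + 1 := by
    have := Fintype.card_range_le x
    rw [Fintype.card_fin] at this
    omega
  let e := Fintype.equivFin (Set.range x)
  choose r hr using fun z : Set.range x => z.2
  let f : Fin k → Fin n := fun i => r (e.symm i)
  have hxf : ∀ i, x (f i) = e.symm i := fun i => hr _
  have hinj : Function.Injective (x ∘ f) := by
    intro i j hij
    simp only [Function.comp, hxf] at hij
    exact e.symm.injective (Subtype.ext hij)
  obtain ⟨hdet, hM⟩ := hG.gram ⟨k, hkn⟩ f hinj
  set G := hiddenGram σ m W (x ∘ f) with hGdef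
  set y : Fin k → ℝ := fun i => g (x (f i)) with hy
  set c := G⁻¹ *ᵥ y with hc
  set h := hiddenMatrix σ m W (x ∘ f) with hh
  have hGc : G *ᵥ c = y := by
    rw [hc, Matrix.mulVec_mulVec, Matrix.mul_nonsing_inv _ (isUnit_iff_ne_zero.2 hdet),
      Matrix.one_mulVec]
  have hint : h *ᵥ (hᵀ *ᵥ c) = y := by rw [Matrix.mulVec_mulVec]; exact hGc
  refine ⟨hᵀ *ᵥ c, fun i => ?_, ?_, ?_⟩
  · have h1 := congrFun hint (e ⟨x i, i, rfl⟩)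
    have h2 : x (f (e ⟨x i, i, rfl⟩)) = x i := by rw [hxf]; simp
    simp only [hy, h2] at h1
    rw [← h1]
    simp only [Matrix.mulVec, hh, hiddenMatrix, Matrix.of_apply, Function.comp, h2]
    rfl
  · calc (hᵀ *ᵥ c) ⬝ᵥ (hᵀ *ᵥ c) = y ⬝ᵥ c := by
          rw [Matrix.mulVec_transpose, ← Matrix.dotProduct_mulVec, ← Matrix.mulVec_transpose, hint,
            dotProduct_comm]
      _ ≤ M := hM
  · rw [Matrix.mulVec_transpose, Matrix.vecMul_eq_sum]
    refine Submodule.sum_mem _ fun i _ => Submodule.smul_mem _ _ (Submodule.subset_span ?_)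
    exact ⟨f i, rfl⟩

end GramMatrix

/-! ### Strong law of large numbers on an infinite product -/

section LawOfLargeNumbers

variable {α : Type*} [MeasurableSpace α]

theorem measurePreserving_pi_precomp (μ : Measure α) [IsProbabilityMeasure μ] {k n : ℕ}
    {f : Fin k → Fin n} (hf : Function.Injective f) :
    MeasurePreserving (fun (x : Fin n → α) i => x (f i)) (Measure.pi fun _ => μ)
      (Measure.pi fun _ => μ) := by
  refine ⟨by fun_prop, ?_⟩
  rw [← Measure.infinitePi_eq_pi, ← Measure.infinitePi_eq_pi]
  exact Measure.map_infinitePi_infinitePi_of_inj (P := fun _ : Fin n => μ) hf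

/-- Couples all widths: the network of width `m` reads the first `m` terms of one infinite weight
sequence, so almost sure limits in `m` make sense. -/
theorem measurePreserving_infinitePi_restrict_fin (μ : Measure α) [IsProbabilityMeasure μ] (n : ℕ) :
    MeasurePreserving (fun (w : ℕ → α) (i : Fin n) => w i) (Measure.infinitePi fun _ => μ)
      (Measure.pi fun _ => μ) := by
  refine ⟨by fun_prop, ?_⟩
  rw [← Measure.infinitePi_eq_pi]
  exact Measure.map_infinitePi_infinitePi_of_inj (P := fun _ : ℕ => μ) Fin.val_injective

theorem ae_tendsto_sum_div (μ : Measure α) [IsProbabilityMeasure μ] {ψ : α → ℝ}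
    (hm : Measurable ψ) (hψ : Integrable ψ μ) :
    ∀ᵐ w ∂(Measure.infinitePi fun _ : ℕ => μ),
      Tendsto (fun m : ℕ => (∑ j : Fin m, ψ (w j)) / m) atTop (nhds (∫ z, ψ z ∂μ)) := by
  have hmp : ∀ i, MeasurePreserving (fun w : ℕ → α => w i) (Measure.infinitePi fun _ : ℕ => μ) μ :=
    fun i => measurePreserving_eval_infinitePi (fun _ => μ) i
  have h := ProbabilityTheory.strong_law_ae_real (μ := Measure.infinitePi fun _ : ℕ => μ)
    (fun i w => ψ (w i)) ((hmp 0).integrable_comp_of_integrable hψ)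
    (fun i j hij => (ProbabilityTheory.iIndepFun_infinitePi (P := fun _ : ℕ => μ)
      (X := fun _ => ψ) fun _ => hm).indepFun hij)
    (fun i => ⟨(hm.comp (hmp i).measurable).aemeasurable,
      (hm.comp (hmp 0).measurable).aemeasurable, by
      have e : ∀ i : ℕ, Measure.map (fun w : ℕ → α => ψ (w i)) (Measure.infinitePi fun _ : ℕ => μ)
          = Measure.map ψ μ := fun i => by
        rw [← (hmp i).map_eq, Measure.map_map hm (hmp i).measurable, (hmp i).map_eq]
        rfl
      rw [e, e]⟩)
  have hI : ∫ w, ψ (w 0) ∂(Measure.infinitePi fun _ : ℕ => μ) = ∫ z, ψ z ∂μ := by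
    have := integral_map (μ := Measure.infinitePi fun _ : ℕ => μ)
      (hmp 0).measurable.aemeasurable (f := ψ) hm.aestronglyMeasurable
    rw [(hmp 0).map_eq] at this
    exact this.symm
  rw [← hI]
  filter_upwards [h] with w hw
  simpa only [Finset.sum_range] using hw

end LawOfLargeNumbers

/-! ### Wide hidden layers are good with high probability -/

section GramConvergence

variable {d n : ℕ}

theorem measurable_activation {σ : ℝ → ℝ} (hσ : Measurable σ) (x : EuclideanSpace ℝ (Fin d)) :
    Measurable fun w : EuclideanSpace ℝ (Fin d) => σ ⟪w, x⟫_ℝ := by fun_prop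

theorem ae_tendsto_hiddenRow_dotProduct {σ : ℝ → ℝ} (hσ : Measurable σ)
    (ν : Measure (EuclideanSpace ℝ (Fin d))) [IsProbabilityMeasure ν]
    {x x' : EuclideanSpace ℝ (Fin d)} (hx : MemLp (fun w => σ ⟪w, x⟫_ℝ) 2 ν)
    (hx' : MemLp (fun w => σ ⟪w, x'⟫_ℝ) 2 ν) :
    ∀ᵐ w ∂(Measure.infinitePi fun _ : ℕ => ν),
      Tendsto (fun m : ℕ => hiddenRow σ m (fun j => w j) x ⬝ᵥ hiddenRow σ m (fun j => w j) x')
        atTop (nhds (nngpKernel σ ν x x')) := by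
  simp only [hiddenRow_dotProduct]
  exact ae_tendsto_sum_div ν ((measurable_activation hσ x).mul (measurable_activation hσ x'))
    (hx.integrable_mul hx')

/-- The mean square of the features over `D` is itself an average over hidden units, of `φ (w j)`,
where by Tonelli `φ` has mean at most `ENNReal.ofReal κ`. The strong law applies because `φ` is
integrable and almost surely finite. -/
theorem ae_eventually_lintegral_hiddenRow_le {σ : ℝ → ℝ} (hσ : Measurable σ)
    (ν : Measure (EuclideanSpace ℝ (Fin d))) [IsProbabilityMeasure ν]
    (D : Measure (EuclideanSpace ℝ (Fin d))) [IsProbabilityMeasure D] {κ κ' : ℝ}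
    (hD : ∀ᵐ x ∂D, MemLp (fun w => σ ⟪w, x⟫_ℝ) 2 ν ∧ nngpKernel σ ν x x ≤ κ)
    (h0 : 0 < κ') (hκ : κ < κ') :
    ∀ᵐ w ∂(Measure.infinitePi fun _ : ℕ => ν), ∀ᶠ m : ℕ in atTop,
      ∫⁻ z, ENNReal.ofReal (hiddenRow σ m (fun j => w j) z ⬝ᵥ hiddenRow σ m (fun j => w j) z) ∂D
        ≤ ENNReal.ofReal κ' := by
  set φ : EuclideanSpace ℝ (Fin d) → ℝ≥0∞ := fun w =>
    ∫⁻ z, ENNReal.ofReal (σ ⟪w, z⟫_ℝ * σ ⟪w, z⟫_ℝ) ∂D with hφ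
  have hjm : Measurable fun p : EuclideanSpace ℝ (Fin d) × EuclideanSpace ℝ (Fin d) =>
      ENNReal.ofReal (σ ⟪p.1, p.2⟫_ℝ * σ ⟪p.1, p.2⟫_ℝ) := by fun_prop
  have hφm : Measurable φ := hjm.lintegral_prod_right'
  have hφI : ∫⁻ w, φ w ∂ν ≤ ENNReal.ofReal κ := by
    rw [hφ, lintegral_lintegral_swap hjm.aemeasurable]
    calc _ ≤ ∫⁻ _, ENNReal.ofReal κ ∂D := by
          refine lintegral_mono_ae ?_
          filter_upwards [hD] with z hz
          have hzi : Integrable (fun w => σ ⟪w, z⟫_ℝ * σ ⟪w, z⟫_ℝ) ν :=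
            hz.1.integrable_mul hz.1
          rw [← ofReal_integral_eq_lintegral_ofReal hzi
            (Eventually.of_forall fun w => mul_self_nonneg _)]
          exact ENNReal.ofReal_le_ofReal hz.2
      _ = _ := by simp
  have hφt : ∫⁻ w, φ w ∂ν ≠ ∞ := ne_top_of_le_ne_top ENNReal.ofReal_ne_top hφI
  have hfin : ∀ᵐ w ∂ν, φ w < ∞ := ae_lt_top hφm hφt
  have hint : ∫ w, (φ w).toReal ∂ν < κ' := by
    rw [integral_toReal hφm.aemeasurable hfin]
    refine (ENNReal.toReal_mono ENNReal.ofReal_ne_top hφI).trans_lt ?_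
    rw [ENNReal.toReal_ofReal']
    exact max_lt hκ h0
  have hfin' : ∀ᵐ w ∂(Measure.infinitePi fun _ : ℕ => ν), ∀ j : ℕ, φ (w j) < ∞ :=
    ae_all_iff.2 fun j =>
      (measurePreserving_eval_infinitePi (fun _ => ν) j).quasiMeasurePreserving.ae hfin
  filter_upwards [hfin', ae_tendsto_sum_div ν hφm.ennreal_toReal
    (integrable_toReal_of_lintegral_ne_top hφm.aemeasurable hφt)] with w hw hlim
  filter_upwards [hlim.eventually (gt_mem_nhds hint), eventually_gt_atTop 0] with m hm hm0
  have hm0' : (0 : ℝ) < m := by exact_mod_cast hm0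
  have hmeas : ∀ j : Fin m, Measurable fun z : EuclideanSpace ℝ (Fin d) =>
      ENNReal.ofReal (σ ⟪w j, z⟫_ℝ * σ ⟪w j, z⟫_ℝ) := fun j => by fun_prop
  calc _ = (∑ j : Fin m, φ (w j)) / ENNReal.ofReal m := by
        simp only [hiddenRow_dotProduct, ENNReal.ofReal_div_of_pos hm0']
        simp only [div_eq_mul_inv]
        rw [lintegral_mul_const'' _ (by fun_prop)]
        congr 1
        rw [← lintegral_finsetSum _ fun j _ => hmeas j]
        refine lintegral_congr fun z => ?_
        rw [ENNReal.ofReal_sum_of_nonneg fun j _ => mul_self_nonneg _]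
    _ = ENNReal.ofReal ((∑ j : Fin m, (φ (w j)).toReal) / m) := by
        rw [ENNReal.ofReal_div_of_pos hm0', ENNReal.ofReal_sum_of_nonneg fun j _ =>
          ENNReal.toReal_nonneg]
        congr 1
        exact Finset.sum_congr rfl fun j _ => (ENNReal.ofReal_toReal (hw j).ne).symm
    _ ≤ _ := ENNReal.ofReal_le_ofReal hm.le

/-- The entries converge and the limit determinant is nonzero, so the inverse quadratic form
converges; the gap `M < M'` absorbs the error at finite width. -/
theorem ae_eventually_gram {σ : ℝ → ℝ} (hσ : Measurable σ)
    (ν : Measure (EuclideanSpace ℝ (Fin d))) [IsProbabilityMeasure ν] {k : ℕ}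
    {x : Fin k → EuclideanSpace ℝ (Fin d)} (hx : ∀ i, MemLp (fun w => σ ⟪w, x i⟫_ℝ) 2 ν)
    {y : Fin k → ℝ} {M M' : ℝ} (hM : M < M') (hu : IsUnit (nngpGram σ ν x))
    (hy : y ⬝ᵥ ((nngpGram σ ν x)⁻¹ *ᵥ y) ≤ M) :
    ∀ᵐ w ∂(Measure.infinitePi fun _ : ℕ => ν), ∀ᶠ m : ℕ in atTop,
      (hiddenGram σ m (fun j => w j) x).det ≠ 0 ∧
        y ⬝ᵥ ((hiddenGram σ m (fun j => w j) x)⁻¹ *ᵥ y) ≤ M' := by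
  have h : ∀ᵐ w ∂(Measure.infinitePi fun _ : ℕ => ν), ∀ i j,
      Tendsto (fun m : ℕ => hiddenRow σ m (fun j => w j) (x i)
        ⬝ᵥ hiddenRow σ m (fun j => w j) (x j)) atTop (nhds (nngpKernel σ ν (x i) (x j))) :=
    ae_all_iff.2 fun i => ae_all_iff.2 fun j =>
      ae_tendsto_hiddenRow_dotProduct hσ ν (hx i) (hx j)
  filter_upwards [h] with w hw
  have hG : Tendsto (fun m : ℕ => hiddenGram σ m (fun j => w j) x) atTop
      (nhds (nngpGram σ ν x)) :=
    tendsto_pi_nhds.2 fun i => tendsto_pi_nhds.2 fun j => hw i j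
  have hdet0 : (nngpGram σ ν x).det ≠ 0 := ((Matrix.isUnit_iff_isUnit_det _).1 hu).ne_zero
  have hdet : Tendsto (fun m : ℕ => (hiddenGram σ m (fun j => w j) x).det) atTop
      (nhds (nngpGram σ ν x).det) :=
    ((Continuous.matrix_det continuous_id).tendsto (nngpGram σ ν x)).comp hG
  have hadj : Continuous fun G : Matrix (Fin k) (Fin k) ℝ => y ⬝ᵥ (G.adjugate *ᵥ y) :=
    Continuous.dotProduct continuous_const (Continuous.matrix_mulVec
      (Continuous.matrix_adjugate continuous_id) continuous_const)
  have hq := (hdet.inv₀ hdet0).mul ((hadj.tendsto _).comp hG)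
  rw [← dotProduct_inv_mulVec] at hq
  filter_upwards [hdet.eventually_ne hdet0, hq.eventually (gt_mem_nhds (hy.trans_lt hM))]
    with m hm1 hm2
  refine ⟨hm1, ?_⟩
  rw [dotProduct_inv_mulVec]
  exact hm2.le

theorem ae_eventually_isGoodDraw {σ : ℝ → ℝ} (hσ : Measurable σ)
    (ν : Measure (EuclideanSpace ℝ (Fin d))) [IsProbabilityMeasure ν]
    (D : Measure (EuclideanSpace ℝ (Fin d))) [IsProbabilityMeasure D] {κ κ' : ℝ}
    (hD : ∀ᵐ x ∂D, MemLp (fun w => σ ⟪w, x⟫_ℝ) 2 ν ∧ nngpKernel σ ν x x ≤ κ)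
    (h0 : 0 < κ') (hκ : κ < κ') {g : EuclideanSpace ℝ (Fin d) → ℝ} {M M' : ℝ} (hM : M < M')
    {x : Fin n → EuclideanSpace ℝ (Fin d)}
    (hx : ∀ i, MemLp (fun w => σ ⟪w, x i⟫_ℝ) 2 ν ∧ nngpKernel σ ν (x i) (x i) ≤ κ)
    (hg : ∀ (k : ℕ) (f : Fin k → Fin n), Function.Injective (x ∘ f) →
      IsUnit (nngpGram σ ν (x ∘ f)) ∧ (fun i => g (x (f i))) ⬝ᵥ
        ((nngpGram σ ν (x ∘ f))⁻¹ *ᵥ fun i => g (x (f i))) ≤ M) :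
    ∀ᵐ w ∂(Measure.infinitePi fun _ : ℕ => ν), ∀ᶠ m : ℕ in atTop,
      IsGoodDraw σ D g κ' M' x fun j : Fin m => w j := by
  have h1 : ∀ᵐ w ∂(Measure.infinitePi fun _ : ℕ => ν), ∀ i,
      Tendsto (fun m : ℕ => hiddenRow σ m (fun j => w j) (x i)
        ⬝ᵥ hiddenRow σ m (fun j => w j) (x i)) atTop (nhds (nngpKernel σ ν (x i) (x i))) :=
    ae_all_iff.2 fun i => ae_tendsto_hiddenRow_dotProduct hσ ν (hx i).1 (hx i).1
  have h2 : ∀ᵐ w ∂(Measure.infinitePi fun _ : ℕ => ν), ∀ (k : Fin (n + 1)) (f : Fin k → Fin n),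
      ∀ᶠ m : ℕ in atTop, Function.Injective (x ∘ f) →
        (hiddenGram σ m (fun j => w j) (x ∘ f)).det ≠ 0 ∧ (fun i => g (x (f i))) ⬝ᵥ
          ((hiddenGram σ m (fun j => w j) (x ∘ f))⁻¹ *ᵥ fun i => g (x (f i))) ≤ M' := by
    refine ae_all_iff.2 fun k => ae_all_iff.2 fun f => ?_
    by_cases hf : Function.Injective (x ∘ f)
    · obtain ⟨hu, hy⟩ := hg k f hf
      filter_upwards [ae_eventually_gram hσ ν (x := x ∘ f) (fun i => (hx (f i)).1) hM hu hy]
        with w hw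
      filter_upwards [hw] with m hm _ using hm
    · exact Eventually.of_forall fun w => Eventually.of_forall fun m h => absurd h hf
  filter_upwards [h1, h2, ae_eventually_lintegral_hiddenRow_le hσ ν D hD h0 hκ] with w hw1 hw2 hw3
  have hw1' : ∀ᶠ m : ℕ in atTop, ∀ i, hiddenRow σ m (fun j => w j) (x i)
      ⬝ᵥ hiddenRow σ m (fun j => w j) (x i) < κ' :=
    eventually_all.2 fun i => (hw1 i).eventually (gt_mem_nhds ((hx i).2.trans_lt hκ))
  have hw2' := eventually_all.2 fun k => eventually_all.2 fun f => hw2 k f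
  filter_upwards [hw1', hw2', hw3] with m hm1 hm2 hm3
  exact ⟨fun i => (hm1 i).le, hm2, hm3⟩

/-- For a fixed sample, almost sure convergence in the coupled space becomes convergence of
probabilities at each width; dominated convergence then integrates over samples. -/
theorem tendsto_measure_not_isGoodDraw {σ : ℝ → ℝ} (hσ : Measurable σ)
    (ν : Measure (EuclideanSpace ℝ (Fin d))) [IsProbabilityMeasure ν]
    (D : Measure (EuclideanSpace ℝ (Fin d))) [IsProbabilityMeasure D] {κ κ' : ℝ}
    (hD : ∀ᵐ x ∂D, MemLp (fun w => σ ⟪w, x⟫_ℝ) 2 ν ∧ nngpKernel σ ν x x ≤ κ)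
    (h0 : 0 < κ') (hκ : κ < κ') {g : EuclideanSpace ℝ (Fin d) → ℝ} (hg : Measurable g)
    {M M' : ℝ} (hM : M < M') (hG : GramBound σ ν D g M) (n : ℕ) :
    Tendsto (fun m : ℕ => ((Measure.pi fun _ : Fin n => D).prod (Measure.pi fun _ : Fin m => ν))
      {p | ¬ IsGoodDraw σ D g κ' M' p.1 p.2}) atTop (nhds 0) := by
  have hmeas : ∀ m, MeasurableSet
      {p : (Fin n → EuclideanSpace ℝ (Fin d)) × (Fin m → EuclideanSpace ℝ (Fin d)) |
        ¬ IsGoodDraw σ D g κ' M' p.1 p.2} := fun m =>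
    (measurableSet_isGoodDraw hσ D hg κ' M').compl
  have hx1 : ∀ᵐ x ∂(Measure.pi fun _ : Fin n => D), ∀ i,
      MemLp (fun w => σ ⟪w, x i⟫_ℝ) 2 ν ∧ nngpKernel σ ν (x i) (x i) ≤ κ :=
    ae_all_iff.2 fun i => (measurePreserving_eval (fun _ => D) i).quasiMeasurePreserving.ae hD
  have hx2 : ∀ᵐ x ∂(Measure.pi fun _ : Fin n => D), ∀ (k : ℕ) (f : Fin k → Fin n),
      Function.Injective (x ∘ f) → IsUnit (nngpGram σ ν (x ∘ f)) ∧ (fun i => g (x (f i))) ⬝ᵥ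
        ((nngpGram σ ν (x ∘ f))⁻¹ *ᵥ fun i => g (x (f i))) ≤ M := by
    refine ae_all_iff.2 fun k => ae_all_iff.2 fun f => ?_
    -- Distinct coordinates of an i.i.d. sample are i.i.d., so the Gram bound for samples of size
    -- `k` transfers to the selected points.
    by_cases hf : Function.Injective f
    · exact (measurePreserving_pi_precomp D hf).quasiMeasurePreserving.ae (hG k)
    · exact Eventually.of_forall fun x h => absurd h.of_comp hf
  have hpt : ∀ᵐ x ∂(Measure.pi fun _ : Fin n => D),
      Tendsto (fun m : ℕ => (Measure.pi fun _ : Fin m => ν)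
        (Prod.mk x ⁻¹' {p | ¬ IsGoodDraw σ D g κ' M' p.1 p.2})) atTop (nhds 0) := by
    filter_upwards [hx1, hx2] with x hx1 hx2
    have hae := ae_eventually_isGoodDraw hσ ν D hD h0 hκ hM hx1 hx2
    have hms : ∀ m : ℕ, MeasurableSet
        (Prod.mk x ⁻¹' {p : (Fin n → EuclideanSpace ℝ (Fin d)) ×
          (Fin m → EuclideanSpace ℝ (Fin d)) | ¬ IsGoodDraw σ D g κ' M' p.1 p.2}) := fun m =>
      measurable_prodMk_left (hmeas m)
    have := tendsto_measure_of_ae_tendsto_indicator_of_isFiniteMeasure (L := atTop)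
      (μ := Measure.infinitePi fun _ : ℕ => ν) (A := ∅)
      (As := fun m : ℕ => (fun (w : ℕ → EuclideanSpace ℝ (Fin d)) (i : Fin m) => w i) ⁻¹'
        (Prod.mk x ⁻¹' {p | ¬ IsGoodDraw σ D g κ' M' p.1 p.2})) MeasurableSet.empty
      (fun m => (measurePreserving_infinitePi_restrict_fin ν m).measurable (hms m))
      (by
        filter_upwards [hae] with w hw
        filter_upwards [hw] with m hm
        simp [hm])
    rw [measure_empty] at this
    refine this.congr fun m => ?_
    exact (measurePreserving_infinitePi_restrict_fin ν m).measure_preimage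
      (hms m).nullMeasurableSet
  have := tendsto_lintegral_of_dominated_convergence (μ := Measure.pi fun _ : Fin n => D)
    (f := fun _ => 0)
    (F := fun m x => (Measure.pi fun _ : Fin m => ν)
        (Prod.mk x ⁻¹' {p | ¬ IsGoodDraw σ D g κ' M' p.1 p.2})) (fun _ => 1)
    (fun m => measurable_measure_prodMk_left (hmeas m))
    (fun m => Eventually.of_forall fun x => prob_le_one) (by simp) hpt
  rw [lintegral_zero] at this
  refine this.congr fun m => ?_
  rw [Measure.prod_apply (hmeas m)]

end GramConvergence

/-! ### Deviation and training loss of the network -/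

section Learning

variable {d n m : ℕ}

theorem IsLipschitzLoss.mono {ℓ : ℝ → ℝ → ℝ} {b b' : ℝ} (h : IsLipschitzLoss ℓ b) (hb : b ≤ b') :
    IsLipschitzLoss ℓ b' :=
  ⟨h.measurable, h.lipschitz, h.diag, h.nonneg, fun y z => (h.le y z).trans hb⟩

theorem IsLipschitzLoss.abs_sub_le {ℓ : ℝ → ℝ → ℝ} {b : ℝ} (h : IsLipschitzLoss ℓ b) (y z z' : ℝ) :
    |ℓ y z - ℓ y z'| ≤ |z - z'| := by
  simpa [Real.dist_eq] using (h.lipschitz y).dist_le_mul z z'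

theorem IsLipschitzLoss.le_abs_sub {ℓ : ℝ → ℝ → ℝ} {b : ℝ} (h : IsLipschitzLoss ℓ b) (y z : ℝ) :
    ℓ y z ≤ |z - y| := by
  have := h.abs_sub_le y z y
  rw [h.diag, sub_zero] at this
  exact (le_abs_self _).trans this

/-- Loss at `x` of the network with hidden weights `W` and final-layer weights `a`. -/
noncomputable def networkLoss (σ : ℝ → ℝ) (ℓ : ℝ → ℝ → ℝ) (g : EuclideanSpace ℝ (Fin d) → ℝ)
    (W : Fin m → EuclideanSpace ℝ (Fin d)) (a : Fin m → ℝ) (x : EuclideanSpace ℝ (Fin d)) : ℝ :=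
  ℓ (g x) (hiddenRow σ m W x ⬝ᵥ a)

/-- Sum over the sample of the differences between the expected loss and the sample losses. -/
noncomputable def deviation (σ : ℝ → ℝ) (D : Measure (EuclideanSpace ℝ (Fin d)))
    (ℓ : ℝ → ℝ → ℝ) (g : EuclideanSpace ℝ (Fin d) → ℝ)
    (x : Fin n → EuclideanSpace ℝ (Fin d)) (W : Fin m → EuclideanSpace ℝ (Fin d))
    (a : Fin m → ℝ) : ℝ :=
  ∑ k, (∫ z, networkLoss σ ℓ g W a z ∂D - networkLoss σ ℓ g W a (x k))

theorem measurable_networkLoss {α : Type*} [MeasurableSpace α] {σ : ℝ → ℝ} (hσ : Measurable σ)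
    {ℓ : ℝ → ℝ → ℝ} (hℓ : Measurable (Function.uncurry ℓ))
    {g : EuclideanSpace ℝ (Fin d) → ℝ} (hg : Measurable g)
    {W : α → Fin m → EuclideanSpace ℝ (Fin d)} (hW : Measurable W)
    {a : α → Fin m → ℝ} (ha : Measurable a)
    {x : α → EuclideanSpace ℝ (Fin d)} (hx : Measurable x) :
    Measurable fun p => networkLoss σ ℓ g (W p) (a p) (x p) := by
  have h (j : Fin m) := measurable_hiddenRow hσ hW hx j
  have h2 : Measurable fun p => hiddenRow σ m (W p) (x p) ⬝ᵥ a p := by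
    simp only [dotProduct]
    fun_prop
  exact hℓ.comp ((hg.comp hx).prodMk h2)

theorem measurable_deviation {σ : ℝ → ℝ} (hσ : Measurable σ)
    (D : Measure (EuclideanSpace ℝ (Fin d))) [IsProbabilityMeasure D]
    {ℓ : ℝ → ℝ → ℝ} (hℓ : Measurable (Function.uncurry ℓ))
    {g : EuclideanSpace ℝ (Fin d) → ℝ} (hg : Measurable g) (a : Fin m → ℝ) :
    Measurable fun p : (Fin n → EuclideanSpace ℝ (Fin d)) × (Fin m → EuclideanSpace ℝ (Fin d)) =>
      deviation σ D ℓ g p.1 p.2 a := by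
  unfold deviation
  refine Finset.measurable_sum _ fun k _ => Measurable.sub ?_ ?_
  · have h : Measurable fun p : ((Fin n → EuclideanSpace ℝ (Fin d)) ×
        (Fin m → EuclideanSpace ℝ (Fin d))) × EuclideanSpace ℝ (Fin d) =>
        networkLoss σ ℓ g p.1.2 a p.2 :=
      measurable_networkLoss hσ hℓ hg (by fun_prop) measurable_const (by fun_prop)
    exact (h.stronglyMeasurable.integral_prod_right' (ν := D)).measurable
  · exact measurable_networkLoss hσ hℓ hg (by fun_prop) measurable_const (by fun_prop)

theorem continuous_deviation {σ : ℝ → ℝ} (hσ : Measurable σ)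
    (D : Measure (EuclideanSpace ℝ (Fin d))) [IsProbabilityMeasure D]
    {ℓ : ℝ → ℝ → ℝ} {b : ℝ} (hℓ : IsLipschitzLoss ℓ b)
    {g : EuclideanSpace ℝ (Fin d) → ℝ} (hg : Measurable g)
    (x : Fin n → EuclideanSpace ℝ (Fin d)) (W : Fin m → EuclideanSpace ℝ (Fin d)) :
    Continuous fun a => deviation σ D ℓ g x W a := by
  have hc : ∀ z, Continuous fun a => networkLoss σ ℓ g W a z := fun z =>
    (hℓ.lipschitz (g z)).continuous.comp (Continuous.dotProduct continuous_const continuous_id)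
  refine continuous_finsetSum _ fun k _ => Continuous.sub ?_ (hc _)
  refine continuous_of_dominated (bound := fun _ => b) (fun a => ?_) (fun a => ?_)
    (integrable_const _) (Eventually.of_forall hc)
  · exact (measurable_networkLoss hσ hℓ.measurable hg measurable_const measurable_const
      measurable_id).aestronglyMeasurable
  · refine Eventually.of_forall fun z => ?_
    rw [Real.norm_eq_abs, networkLoss, abs_of_nonneg (hℓ.nonneg _ _)]
    exact hℓ.le _ _

theorem memLp_hiddenRow {σ : ℝ → ℝ} (hσ : Measurable σ)
    (D : Measure (EuclideanSpace ℝ (Fin d)))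
    {κ : ℝ} (hκ : 0 ≤ κ) {W : Fin m → EuclideanSpace ℝ (Fin d)}
    (hW : ∫⁻ z, ENNReal.ofReal (hiddenRow σ m W z ⬝ᵥ hiddenRow σ m W z) ∂D ≤ ENNReal.ofReal κ) :
    (∀ j, MemLp (fun z => hiddenRow σ m W z j) 2 D) ∧
      ∑ j, ∫ z, hiddenRow σ m W z j ^ 2 ∂D ≤ κ := by
  have hm (j : Fin m) : Measurable fun z => hiddenRow σ m W z j :=
    measurable_hiddenRow hσ measurable_const measurable_id j
  have hdm : Measurable fun z => hiddenRow σ m W z ⬝ᵥ hiddenRow σ m W z := by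
    simp only [dotProduct]
    fun_prop
  have h0 : 0 ≤ᵐ[D] fun z => hiddenRow σ m W z ⬝ᵥ hiddenRow σ m W z :=
    Eventually.of_forall fun z => dotProduct_self_nonneg_real _
  have hi : Integrable (fun z => hiddenRow σ m W z ⬝ᵥ hiddenRow σ m W z) D :=
    ⟨hdm.aestronglyMeasurable, (hasFiniteIntegral_iff_ofReal h0).2
      (hW.trans_lt ENNReal.ofReal_lt_top)⟩
  have hj : ∀ j, MemLp (fun z => hiddenRow σ m W z j) 2 D := by
    intro j
    rw [memLp_two_iff_integrable_sq (hm j).aestronglyMeasurable]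
    refine hi.mono' ((hm j).pow_const 2).aestronglyMeasurable (Eventually.of_forall fun z => ?_)
    rw [Real.norm_eq_abs, abs_of_nonneg (sq_nonneg _), sq]
    exact Finset.single_le_sum (f := fun j => hiddenRow σ m W z j * hiddenRow σ m W z j)
      (fun _ _ => mul_self_nonneg _) (Finset.mem_univ j)
  refine ⟨hj, ?_⟩
  rw [← integral_finsetSum _ fun j _ => (hj j).integrable_sq]
  have e : ∀ z, ∑ j, hiddenRow σ m W z j ^ 2 = hiddenRow σ m W z ⬝ᵥ hiddenRow σ m W z := fun z =>
    Finset.sum_congr rfl fun j _ => sq _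
  simp only [e]
  rw [integral_eq_lintegral_of_nonneg_ae h0 hdm.aestronglyMeasurable]
  exact ENNReal.toReal_le_of_le_ofReal hκ hW

/-- SGD weights depend on the sample, so the deviation bound must hold on the whole ball. A
countable dense set, with continuity in the weights, avoids measurability problems for uncountable
suprema. -/
theorem exists_seq_dense_dotProduct_self_le {B : ℝ} (hB : 0 ≤ B) :
    ∃ q : ℕ → Fin m → ℝ, (∀ i, q i ⬝ᵥ q i ≤ B) ∧
      ∀ a : Fin m → ℝ, a ⬝ᵥ a ≤ B → a ∈ closure (Set.range q) := by
  let S := {a : Fin m → ℝ // a ⬝ᵥ a ≤ B}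
  have : Nonempty S := ⟨⟨0, by simpa using hB⟩⟩
  refine ⟨fun i => (TopologicalSpace.denseSeq S i).1, fun i => (TopologicalSpace.denseSeq S i).2,
    fun a ha => ?_⟩
  refine map_mem_closure continuous_subtype_val
    (TopologicalSpace.denseRange_denseSeq S ⟨a, ha⟩) ?_
  rintro _ ⟨i, rfl⟩
  exact ⟨i, rfl⟩

/-- Outside of a measurable event of small probability, the deviation is small for all weights in a
ball, if the hidden layer is bounded in mean square. -/
theorem exists_measurableSet_deviation_le {σ : ℝ → ℝ} (hσ : Measurable σ)
    (ν : Measure (EuclideanSpace ℝ (Fin d))) [IsProbabilityMeasure ν]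
    (D : Measure (EuclideanSpace ℝ (Fin d))) [IsProbabilityMeasure D]
    {ℓ : ℝ → ℝ → ℝ} {b : ℝ} (hℓ : IsLipschitzLoss ℓ b) (hb : 0 < b)
    {g : EuclideanSpace ℝ (Fin d) → ℝ} (hg : Measurable g) {κ B θ s : ℝ} (hκ : 0 ≤ κ)
    (hB : 0 ≤ B) (hθ : 0 < θ) (hs : 0 < s) (hn : 0 < n) (m : ℕ) :
    ∃ A : Set ((Fin n → EuclideanSpace ℝ (Fin d)) × (Fin m → EuclideanSpace ℝ (Fin d))),
      MeasurableSet A ∧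
      ((Measure.pi fun _ : Fin n => D).prod (Measure.pi fun _ : Fin m => ν)) A
        ≤ ENNReal.ofReal (Real.exp (-(2 * s ^ 2 / (n * b ^ 2)))) ∧
      ∀ p ∉ A, ∫⁻ z, ENNReal.ofReal (hiddenRow σ m p.2 z ⬝ᵥ hiddenRow σ m p.2 z) ∂D
          ≤ ENNReal.ofReal κ → ∀ a : Fin m → ℝ, a ⬝ᵥ a ≤ B →
        deviation σ D ℓ g p.1 p.2 a ≤ θ * (n * κ) + B / θ + s := by
  obtain ⟨q, hqB, hq⟩ := exists_seq_dense_dotProduct_self_le (m := m) hB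
  set t := θ * (n * κ) + B / θ + s with ht
  set A : Set ((Fin n → EuclideanSpace ℝ (Fin d)) × (Fin m → EuclideanSpace ℝ (Fin d))) :=
    Prod.snd ⁻¹' {W | ∫⁻ z, ENNReal.ofReal (hiddenRow σ m W z ⬝ᵥ hiddenRow σ m W z) ∂D
      ≤ ENNReal.ofReal κ} ∩ ⋃ i, {p | t < deviation σ D ℓ g p.1 p.2 (q i)} with hA
  have hAm : MeasurableSet A :=
    (measurable_snd (measurableSet_lintegral_hiddenRow_le hσ D κ)).inter
      (MeasurableSet.iUnion fun i => measurableSet_lt measurable_const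
        (measurable_deviation hσ D hℓ.measurable hg (q i)))
  refine ⟨A, hAm, ?_, ?_⟩
  -- The hidden weights are fixed first: they are independent of the sample, so each section over
  -- `W` is either empty or an ordinary deviation event.
  · rw [Measure.prod_apply_symm hAm]
    refine (lintegral_mono (g := fun _ =>
      ENNReal.ofReal (Real.exp (-(2 * s ^ 2 / (n * b ^ 2))))) fun W => ?_).trans (by simp)
    by_cases hW : ∫⁻ z, ENNReal.ofReal (hiddenRow σ m W z ⬝ᵥ hiddenRow σ m W z) ∂D
      ≤ ENNReal.ofReal κ
    · obtain ⟨h2, hR⟩ := memLp_hiddenRow hσ D hκ hW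
      refine le_trans (measure_mono ?_) (measure_exists_deviation_le D
        (f := fun i => networkLoss σ ℓ g W (q i)) (h := fun z => hiddenRow σ m W z) (q := q)
        (fun i => measurable_networkLoss hσ hℓ.measurable hg measurable_const measurable_const
          measurable_id) hb (fun i x => hℓ.nonneg _ _) (fun i x => hℓ.le _ _)
        (fun j => measurable_hiddenRow hσ measurable_const measurable_id j) h2
        (fun x i j => hℓ.abs_sub_le _ _ _) hθ hs hqB hR hn)
      rintro x ⟨_, hx⟩
      obtain ⟨i, hi⟩ := Set.mem_iUnion.1 hx
      exact ⟨i, hi⟩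
    · have : (fun x => (x, W)) ⁻¹' A = ∅ := by
        ext x
        simp [hA, hW]
      rw [this, measure_empty]
      exact zero_le
  · intro p hp hW a ha
    have hle : ∀ i, deviation σ D ℓ g p.1 p.2 (q i) ≤ t := by
      intro i
      by_contra h
      exact hp ⟨hW, Set.mem_iUnion.2 ⟨i, not_le.1 h⟩⟩
    have hcl : IsClosed {a | deviation σ D ℓ g p.1 p.2 a ≤ t} :=
      isClosed_le (continuous_deviation hσ D hℓ hg p.1 p.2) continuous_const
    exact closure_minimal (by rintro _ ⟨i, rfl⟩; exact hle i) hcl (hq a ha)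

theorem measurable_foldl_sgdStep {α : Type*} [MeasurableSpace α] (η : ℝ)
    {h : α → Matrix (Fin n) (Fin m) ℝ} {y : α → Fin n → ℝ}
    (hh : ∀ i j, Measurable fun p => h p i j) (hy : Measurable y) :
    ∀ (T : ℕ) (e : Fin T → ℕ) (a : α → Fin m → ℝ), Measurable a →
      Measurable fun p => Fin.foldl T (fun a t => sgdStep η (h p) (y p) a (e t)) (a p) := by
  intro T
  induction T with
  | zero => intro e a ha; simpa using ha
  | succ T ih =>
    intro e a ha
    simp only [Fin.foldl_succ]
    refine ih (fun t => e t.succ) (fun p => sgdStep η (h p) (y p) (a p) (e 0)) ?_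
    by_cases hk : e 0 < n
    · simp only [sgdStep, hk, dite_true]
      refine measurable_pi_lambda _ fun j => ?_
      simp only [dotProduct, Pi.sub_apply, Pi.smul_apply, smul_eq_mul]
      have := hh ⟨e 0, hk⟩
      fun_prop
    · simpa [sgdStep, hk] using ha

/-- Sum of the training losses after `T` steps of SGD. -/
noncomputable def trainingLoss (σ : ℝ → ℝ) (ℓ : ℝ → ℝ → ℝ) (g : EuclideanSpace ℝ (Fin d) → ℝ)
    (η : ℝ) (T : ℕ) (x : Fin n → EuclideanSpace ℝ (Fin d)) (W : Fin m → EuclideanSpace ℝ (Fin d))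
    (e : Fin T → ℕ) : ℝ :=
  ∑ k, networkLoss σ ℓ g W (sgdWeights η (hiddenMatrix σ m W x) (fun i => g (x i)) T e) (x k)

/-- There are countably many index sequences `e`, so joint measurability reduces to fixed `e`. -/
theorem measurable_trainingLoss {σ : ℝ → ℝ} (hσ : Measurable σ)
    {ℓ : ℝ → ℝ → ℝ} (hℓ : Measurable (Function.uncurry ℓ))
    {g : EuclideanSpace ℝ (Fin d) → ℝ} (hg : Measurable g) (η : ℝ) (T : ℕ) :
    Measurable fun p : ((Fin n → EuclideanSpace ℝ (Fin d)) × (Fin m → EuclideanSpace ℝ (Fin d))) ×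
      (Fin T → ℕ) => trainingLoss σ ℓ g η T p.1.1 p.1.2 p.2 := by
  refine measurable_from_prod_countable_left fun e => ?_
  refine Finset.measurable_sum _ fun k _ => measurable_networkLoss hσ hℓ hg measurable_snd ?_
    (by fun_prop)
  refine measurable_foldl_sgdStep η (fun i j => ?_) (by fun_prop) T e _ measurable_const
  exact measurable_hiddenRow hσ measurable_snd (by fun_prop) j

/-- By Cauchy–Schwarz, squared distance less than `ε ^ 2 / κ` to an interpolator makes every
training residual, hence every loss, at most `ε`. -/
theorem IsGoodDraw.tendsto_measure_trainingLoss {σ : ℝ → ℝ}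
    {D : Measure (EuclideanSpace ℝ (Fin d))}
    {g : EuclideanSpace ℝ (Fin d) → ℝ} {κ M : ℝ} {x : Fin n → EuclideanSpace ℝ (Fin d)}
    {W : Fin m → EuclideanSpace ℝ (Fin d)} (hG : IsGoodDraw σ D g κ M x W) (hκ : 0 < κ)
    {ℓ : ℝ → ℝ → ℝ} {b : ℝ} (hℓ : IsLipschitzLoss ℓ b) (hn : 0 < n) {η : ℝ} (hη : 0 < η)
    (hηκ : η * κ ≤ 1) {ε : ℝ} (hε : 0 < ε) :
    Tendsto (fun T => (Measure.pi fun _ : Fin T => (exampleLaw n).toMeasure)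
      {e | n * ε < trainingLoss σ ℓ g η T x W e}) atTop (nhds 0) := by
  obtain ⟨s, hs, -, hsp⟩ := hG.exists_interpolation
  have hh : ∀ i, η * (hiddenMatrix σ m W x i ⬝ᵥ hiddenMatrix σ m W x i) ≤ 1 := fun i =>
    (mul_le_mul_of_nonneg_left (hG.norm_le i) hη.le).trans hηκ
  refine tendsto_of_tendsto_of_tendsto_of_le_of_le tendsto_const_nhds
    (tendsto_measure_sgdWeights hn.ne' hη hs hh hsp (c := ε ^ 2 / κ) (by positivity))
    (fun _ => zero_le) fun T => measure_mono fun e he => ?_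
  simp only [Set.mem_ofPred_eq] at he ⊢
  by_contra hlt
  rw [not_le] at hlt
  refine absurd he (not_lt.2 ?_)
  set a := sgdWeights η (hiddenMatrix σ m W x) (fun i => g (x i)) T e with ha
  have hk : ∀ k ∈ Finset.univ, networkLoss σ ℓ g W a (x k) ≤ ε := by
    intro k _
    refine (hℓ.le_abs_sub _ _).trans (abs_le_of_sq_le_sq ?_ hε.le)
    have e1 : hiddenRow σ m W (x k) ⬝ᵥ a - g (x k) = hiddenRow σ m W (x k) ⬝ᵥ (a - s) := by
      rw [dotProduct_sub, ← hs k]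
      rfl
    rw [e1]
    refine (dotProduct_sq_le _ _).trans ?_
    calc _ ≤ κ * (ε ^ 2 / κ) :=
          mul_le_mul (hG.norm_le k) hlt.le (dotProduct_self_nonneg_real _) hκ.le
      _ = ε ^ 2 := by field_simp
  simpa [trainingLoss] using Finset.sum_le_card_nsmul _ _ _ hk

/-- The rate in `T` depends on the conditioning of the draw and is not uniform; dominated
convergence over draws still gives convergence in probability. -/
theorem tendsto_measure_trainingLoss {σ : ℝ → ℝ} (hσ : Measurable σ)
    (ν : Measure (EuclideanSpace ℝ (Fin d))) [IsProbabilityMeasure ν]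
    (D : Measure (EuclideanSpace ℝ (Fin d))) [IsProbabilityMeasure D]
    {g : EuclideanSpace ℝ (Fin d) → ℝ} (hg : Measurable g) {κ : ℝ} (M : ℝ) (hκ : 0 < κ)
    {ℓ : ℝ → ℝ → ℝ} {b : ℝ} (hℓ : IsLipschitzLoss ℓ b) (hn : 0 < n) {η : ℝ} (hη : 0 < η)
    (hηκ : η * κ ≤ 1) {ε : ℝ} (hε : 0 < ε) :
    Tendsto (fun T => (((Measure.pi fun _ : Fin n => D).prod (Measure.pi fun _ : Fin m => ν)).prod
      (Measure.pi fun _ : Fin T => (exampleLaw n).toMeasure))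
      {p | IsGoodDraw σ D g κ M p.1.1 p.1.2 ∧ n * ε < trainingLoss σ ℓ g η T p.1.1 p.1.2 p.2})
      atTop (nhds 0) := by
  have hmeas : ∀ T, MeasurableSet {p : ((Fin n → EuclideanSpace ℝ (Fin d)) ×
      (Fin m → EuclideanSpace ℝ (Fin d))) × (Fin T → ℕ) | IsGoodDraw σ D g κ M p.1.1 p.1.2 ∧
        n * ε < trainingLoss σ ℓ g η T p.1.1 p.1.2 p.2} := fun T =>
    (measurable_fst (measurableSet_isGoodDraw hσ D hg κ M)).inter
      (measurableSet_lt measurable_const (measurable_trainingLoss hσ hℓ.measurable hg η T))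
  have := tendsto_lintegral_of_dominated_convergence
    (μ := (Measure.pi fun _ : Fin n => D).prod (Measure.pi fun _ : Fin m => ν))
    (f := fun _ => 0)
    (F := fun T p => (Measure.pi fun _ : Fin T => (exampleLaw n).toMeasure)
        (Prod.mk p ⁻¹' {p | IsGoodDraw σ D g κ M p.1.1 p.1.2 ∧
          n * ε < trainingLoss σ ℓ g η T p.1.1 p.1.2 p.2})) (fun _ => 1)
    (fun T => measurable_measure_prodMk_left (hmeas T))
    (fun T => Eventually.of_forall fun p => prob_le_one) (by simp)
    (Eventually.of_forall fun p => by
      by_cases hp : IsGoodDraw σ D g κ M p.1 p.2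
      · simpa [hp] using hp.tendsto_measure_trainingLoss hκ hℓ hn hη hηκ hε
      · simp [hp])
  rw [lintegral_zero] at this
  refine this.congr fun T => ?_
  rw [Measure.prod_apply (hmeas T)]

end Learning

/-! ### From deviation bounds to sample complexity -/

section SampleComplexity

variable {d n m : ℕ}

theorem genError_le_of_deviation_le {σ : ℝ → ℝ} {D : Measure (EuclideanSpace ℝ (Fin d))}
    {ℓ : ℝ → ℝ → ℝ} {g : EuclideanSpace ℝ (Fin d) → ℝ} {x : Fin n → EuclideanSpace ℝ (Fin d)}
    {W : Fin m → EuclideanSpace ℝ (Fin d)} {a : Fin m → ℝ} {u v : ℝ}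
    (hdev : deviation σ D ℓ g x W a ≤ u) (htr : ∑ k, networkLoss σ ℓ g W a (x k) ≤ v) :
    n * genError D ℓ g (fun z => hiddenRow σ m W z ⬝ᵥ a) ≤ u + v := by
  rw [deviation, Finset.sum_sub_distrib] at hdev
  simp only [Finset.sum_const, Finset.card_univ, Fintype.card_fin, nsmul_eq_mul] at hdev
  change n * ∫ z, networkLoss σ ℓ g W a z ∂D ≤ _
  linarith

/-- SGD learns from `n` examples if the uniform deviation bound at `n` is below `ε / 2` with
probability greater than `1 - δ`. -/
theorem eventually_learnsFrom {σ : ℝ → ℝ} (hσ : Measurable σ)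
    (ν : Measure (EuclideanSpace ℝ (Fin d))) [IsProbabilityMeasure ν]
    (D : Measure (EuclideanSpace ℝ (Fin d))) [IsProbabilityMeasure D] {κ κ' : ℝ}
    (hD : ∀ᵐ x ∂D, MemLp (fun w => σ ⟪w, x⟫_ℝ) 2 ν ∧ nngpKernel σ ν x x ≤ κ)
    (h0 : 0 < κ') (hκ : κ < κ') {g : EuclideanSpace ℝ (Fin d) → ℝ} (hg : Measurable g)
    {M M' : ℝ} (hM : M < M') (hM0 : 0 ≤ M) (hG : GramBound σ ν D g M)
    {ℓ : ℝ → ℝ → ℝ} {b : ℝ} (hℓ : IsLipschitzLoss ℓ b) (hb : 0 < b) (hn : 0 < n)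
    {ε δ θ : ℝ} (hε : 0 < ε) (hδ1 : δ < 1) (hθ : 0 < θ)
    (ht : θ * (n * κ') + 4 * M' / θ ≤ n * (ε / 4))
    (hp : Real.exp (-(2 * (n * (ε / 4)) ^ 2 / (n * b ^ 2))) < δ) :
    ∀ᶠ m : ℕ in atTop, ∀ η : ℝ, 0 < η → η * κ' ≤ 1 → ∀ᶠ T : ℕ in atTop,
      LearnsFrom (sgdLearner σ ν m η T) D ℓ g ε δ n := by
  have hn' : (0 : ℝ) < n := by exact_mod_cast hn
  set r := Real.exp (-(2 * (n * (ε / 4)) ^ 2 / (n * b ^ 2))) with hr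
  have hr0 : 0 < r := Real.exp_pos _
  -- The deviation event costs `r < δ`; the rest of the budget is split evenly between bad draws
  -- (large `m`) and unfinished training (large `T`).
  have hgap : 0 < ENNReal.ofReal ((δ - r) / 2) := ENNReal.ofReal_pos.2 (by linarith)
  filter_upwards [(tendsto_measure_not_isGoodDraw hσ ν D hD h0 hκ hg hM hG n).eventually
    (gt_mem_nhds hgap)] with m hm η hη hηκ
  obtain ⟨A, hA, hAr, hAdev⟩ := exists_measurableSet_deviation_le hσ ν D hℓ hb hg (κ := κ')
    (B := 4 * M') (θ := θ) (s := n * (ε / 4)) h0.le (by linarith) hθ (by positivity) hn m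
  filter_upwards [(tendsto_measure_trainingLoss (m := m) hσ ν D hg M' h0 hℓ hn hη hηκ
    (ε := ε / 4) (by linarith)).eventually (gt_mem_nhds hgap)] with T hT
  set PX := Measure.pi fun _ : Fin n => D
  set PW := Measure.pi fun _ : Fin m => ν
  set PE := Measure.pi fun _ : Fin T => (exampleLaw n).toMeasure
  set N : Set ((Fin n → EuclideanSpace ℝ (Fin d)) × (Fin m → EuclideanSpace ℝ (Fin d))) :=
    {p | ¬ IsGoodDraw σ D g κ' M' p.1 p.2} with hN
  have hNm : MeasurableSet N := (measurableSet_isGoodDraw hσ D hg κ' M').compl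
  set R : Set (((Fin n → EuclideanSpace ℝ (Fin d)) × (Fin m → EuclideanSpace ℝ (Fin d))) ×
    (Fin T → ℕ)) := {p | IsGoodDraw σ D g κ' M' p.1.1 p.1.2 ∧
      n * (ε / 4) < trainingLoss σ ℓ g η T p.1.1 p.1.2 p.2} with hR
  have hRm : MeasurableSet R :=
    (measurable_fst (measurableSet_isGoodDraw hσ D hg κ' M')).inter
      (measurableSet_lt measurable_const (measurable_trainingLoss hσ hℓ.measurable hg η T))
  set U := (Prod.fst ⁻¹' N ∪ Prod.fst ⁻¹' A) ∪ R with hU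
  have hUm : MeasurableSet U := ((measurable_fst hNm).union (measurable_fst hA)).union hRm
  have hUP : ((PX.prod PW).prod PE) U < ENNReal.ofReal δ := by
    have hf : ∀ S, MeasurableSet S → ((PX.prod PW).prod PE) (Prod.fst ⁻¹' S) = (PX.prod PW) S :=
      fun S hS => (measurePreserving_fst (μ := PX.prod PW) (ν := PE)).measure_preimage
        hS.nullMeasurableSet
    calc ((PX.prod PW).prod PE) U
        ≤ (PX.prod PW) N + (PX.prod PW) A + ((PX.prod PW).prod PE) R := by
          refine (measure_union_le _ _).trans (add_le_add_left ((measure_union_le _ _).trans ?_) _)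
          rw [hf _ hNm, hf _ hA]
      _ < ENNReal.ofReal ((δ - r) / 2) + ENNReal.ofReal r + ENNReal.ofReal ((δ - r) / 2) := by
          refine ENNReal.add_lt_add (ENNReal.add_lt_add_of_lt_of_le ?_ hm hAr) hT
          exact ne_top_of_le_ne_top ENNReal.ofReal_ne_top hAr
      _ = ENNReal.ofReal δ := by
          rw [← ENNReal.ofReal_add (by linarith) hr0.le, ← ENNReal.ofReal_add (by linarith)
            (by linarith)]
          congr 1
          ring
  have hmp : MeasurePreserving (MeasurableEquiv.prodAssoc) ((PX.prod PW).prod PE)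
      (PX.prod (PW.prod PE)) := measurePreserving_prodAssoc _ _ _
  have hmp' := hmp.symm
  set V := MeasurableEquiv.prodAssoc.symm ⁻¹' U with hV
  have hVm : MeasurableSet V := hmp'.measurable hUm
  have hVP : (PX.prod (PW.prod PE)) V < ENNReal.ofReal δ := by
    rw [hV, hmp'.measure_preimage hUm.nullMeasurableSet]
    exact hUP
  have hcompl : ENNReal.ofReal (1 - δ) < (PX.prod (PW.prod PE)) Vᶜ := by
    rw [prob_compl_eq_one_sub hVm, ENNReal.ofReal_sub _ (hr0.trans hp).le, ENNReal.ofReal_one]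
    refine ENNReal.sub_lt_of_lt_add (ENNReal.ofReal_le_one.2 hδ1.le) ?_
    calc (1 : ℝ≥0∞) = (1 - (PX.prod (PW.prod PE)) V) + (PX.prod (PW.prod PE)) V :=
          (tsub_add_cancel_of_le prob_le_one).symm
      _ < _ := ENNReal.add_lt_add_left (ne_top_of_le_ne_top ENNReal.one_ne_top tsub_le_self) hVP
  -- Only an inclusion of a measurable event is used, so measurability of the learning event itself
  -- is not needed.
  refine hcompl.trans_le (measure_mono ?_)
  rintro ⟨x, W, e⟩ hω
  simp only [hV, hU, hN, hR, Set.mem_compl_iff, Set.mem_preimage, Set.mem_union, not_or,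
    Set.mem_ofPred_eq, not_not, not_and, not_lt] at hω
  obtain ⟨⟨hgood, hxA⟩, htr⟩ := hω
  replace hgood : IsGoodDraw σ D g κ' M' x W := hgood
  replace hxA : (x, W) ∉ A := hxA
  replace htr : trainingLoss σ ℓ g η T x W e ≤ n * (ε / 4) := htr hgood
  obtain ⟨s, hs, hsM, -⟩ := hgood.exists_interpolation
  have hh : ∀ i, η * (hiddenMatrix σ m W x i ⬝ᵥ hiddenMatrix σ m W x i) ≤ 1 := fun i =>
    (mul_le_mul_of_nonneg_left (hgood.norm_le i) hη.le).trans hηκ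
  have ha := sgdWeights_dotProduct_self_le hη hs hh T e
  have hdev := hAdev (x, W) hxA hgood.lintegral_le _ (ha.trans (by linarith))
  have hfin := genError_le_of_deviation_le hdev htr
  change genError D ℓ g (fun z => hiddenRow σ m W z ⬝ᵥ
    sgdWeights η (hiddenMatrix σ m W x) (fun i => g (x i)) T e) < ε
  have : n * genError D ℓ g (fun z => hiddenRow σ m W z ⬝ᵥ
      sgdWeights η (hiddenMatrix σ m W x) (fun i => g (x i)) T e) < n * ε := by
    -- Expected deviation, its fluctuation and the training loss each contribute at most `n * ε /
    -- 4`.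
    refine hfin.trans_lt ?_
    have : 0 < n * ε := by positivity
    linarith
  exact lt_of_mul_lt_mul_left this hn'.le

/-- The empty sample has quadratic form `0`. -/
theorem GramBound.nonneg {σ : ℝ → ℝ} {ν : Measure (EuclideanSpace ℝ (Fin d))}
    {D : Measure (EuclideanSpace ℝ (Fin d))} [IsProbabilityMeasure D]
    {g : EuclideanSpace ℝ (Fin d) → ℝ} {M : ℝ} (hG : GramBound σ ν D g M) : 0 ≤ M := by
  obtain ⟨x, hx⟩ := (hG 0).exists
  simpa using (hx (Function.injective_of_subsingleton _)).2

/-- For a sample of size one the quadratic form is `g x ^ 2 / K(x, x)`. -/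
theorem GramBound.ae_sq_le {σ : ℝ → ℝ} {ν : Measure (EuclideanSpace ℝ (Fin d))}
    {D : Measure (EuclideanSpace ℝ (Fin d))} [IsProbabilityMeasure D]
    {g : EuclideanSpace ℝ (Fin d) → ℝ} {M : ℝ} (hG : GramBound σ ν D g M) :
    ∀ᵐ x ∂D, g x ^ 2 ≤ M * nngpKernel σ ν x x := by
  have h1 := (measurePreserving_funUnique D (Fin 1)).symm.quasiMeasurePreserving.ae (hG 1)
  filter_upwards [h1] with x hx
  set z := (MeasurableEquiv.funUnique (Fin 1) (EuclideanSpace ℝ (Fin d))).symm x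
  have hz : z = fun _ => x := rfl
  obtain ⟨hu, hy⟩ := hx (Function.injective_of_subsingleton _)
  set G := nngpGram σ ν z
  have hG0 : G 0 0 = nngpKernel σ ν x x := rfl
  set c := G⁻¹ *ᵥ fun i => g (z i) with hc
  have hGc : G *ᵥ c = fun i => g (z i) := by
    rw [hc, Matrix.mulVec_mulVec, Matrix.mul_nonsing_inv _ ((Matrix.isUnit_iff_isUnit_det _).1 hu),
      Matrix.one_mulVec]
  have h2 : G 0 0 * c 0 = g x := by
    have := congrFun hGc 0
    simpa [Matrix.mulVec, dotProduct, hz] using this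
  have h3 : g x * c 0 ≤ M := by simpa [dotProduct, hz] using hy
  have h4 : 0 ≤ nngpKernel σ ν x x := integral_nonneg fun w => mul_self_nonneg _
  calc g x ^ 2 = nngpKernel σ ν x x * (g x * c 0) := by
        rw [← hG0, sq]
        nth_rewrite 1 [← h2]
        ring
    _ ≤ nngpKernel σ ν x x * M := mul_le_mul_of_nonneg_left h3 h4
    _ = _ := mul_comm _ _

theorem sgdWeights_of_no_examples (η : ℝ) (h : Matrix (Fin 0) (Fin m) ℝ) (y : Fin 0 → ℝ) (T : ℕ)
    (e : Fin T → ℕ) : sgdWeights η h y T e = 0 := by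
  unfold sgdWeights
  induction T with
  | zero => simp
  | succ T ih =>
    rw [Fin.foldl_succ]
    exact ih fun t => e t.succ

/-- Without examples the weights stay at `0`, and the loss of the zero predictor is at most `|g x| ≤
√(M * κ) < ε` almost everywhere. -/
theorem learnsFrom_zero {σ : ℝ → ℝ}
    (ν : Measure (EuclideanSpace ℝ (Fin d))) [IsProbabilityMeasure ν]
    (D : Measure (EuclideanSpace ℝ (Fin d))) [IsProbabilityMeasure D] {κ : ℝ}
    (hD : ∀ᵐ x ∂D, nngpKernel σ ν x x ≤ κ)
    {g : EuclideanSpace ℝ (Fin d) → ℝ}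
    {M : ℝ} (hG : GramBound σ ν D g M) {ℓ : ℝ → ℝ → ℝ} {b : ℝ} (hℓ : IsLipschitzLoss ℓ b)
    {ε δ : ℝ} (hε : 0 < ε) (hδ : 0 < δ) (hM : M * κ < ε ^ 2) (m : ℕ) (η : ℝ) (T : ℕ) :
    LearnsFrom (sgdLearner σ ν m η T) D ℓ g ε δ 0 := by
  have herr : genError D ℓ g (fun _ => 0) < ε := by
    have hb : ∀ᵐ x ∂D, ℓ (g x) 0 ≤ √(M * κ) := by
      filter_upwards [hD, hG.ae_sq_le] with x hx hgx
      refine (hℓ.le_abs_sub _ _).trans ?_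
      rw [zero_sub, abs_neg]
      exact Real.abs_le_sqrt (hgx.trans (mul_le_mul_of_nonneg_left hx hG.nonneg))
    have h1 : genError D ℓ g (fun _ => 0) ≤ ∫ _, √(M * κ) ∂D :=
      integral_mono_of_nonneg (Eventually.of_forall fun x => hℓ.nonneg _ _) (integrable_const _) hb
    refine h1.trans_lt ?_
    simpa using (Real.sqrt_lt' hε).2 hM
  have hset : {ω : (Fin 0 → EuclideanSpace ℝ (Fin d)) × (sgdLearner σ ν m η T).Seed 0 |
      genError D ℓ g ((sgdLearner σ ν m η T).train 0 ω.1 (fun i => g (ω.1 i)) ω.2) < ε}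
      = Set.univ := by
    refine Set.eq_univ_of_forall fun ω => ?_
    have : (sgdLearner σ ν m η T).train 0 ω.1 (fun i => g (ω.1 i)) ω.2 = fun _ => 0 := by
      funext z
      simp only [sgdLearner, sgdWeights_of_no_examples, dotProduct_zero]
    simpa only [Set.mem_ofPred_eq, this] using herr
  rw [LearnsFrom, hset, measure_univ, ENNReal.ofReal_lt_one]
  linarith

theorem sampleComplexity_le {X : Type} [MeasurableSpace X] {A : RandomizedLearner X}
    {D : Measure X} {ℓ : ℝ → ℝ → ℝ} {g : X → ℝ} {ε δ Q : ℝ} (hQ : 0 ≤ Q)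
    (h : LearnsFrom A D ℓ g ε δ ⌊Q⌋₊) :
    (sampleComplexity A D ℓ g ε δ : ℝ≥0∞) ≤ ENNReal.ofReal Q := by
  have h1 : sampleComplexity A D ℓ g ε δ ≤ (⌊Q⌋₊ : ℕ∞) := sInf_le ⟨_, h, rfl⟩
  calc (sampleComplexity A D ℓ g ε δ : ℝ≥0∞) ≤ ((⌊Q⌋₊ : ℕ∞) : ℝ≥0∞) := by exact_mod_cast h1
    _ = ENNReal.ofReal (⌊Q⌋₊ : ℝ) := by simp
    _ ≤ _ := ENNReal.ofReal_le_ofReal (Nat.floor_le hQ)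

end SampleComplexity

/-! ### Choice of constants and conclusion -/

theorem mainTheorem10 (κ b : ℝ) :
    ∃ C η₀ : ℝ, 0 < C ∧ 0 < η₀ ∧
      ∀ (d : ℕ) (σ : ℝ → ℝ) (_ : Measurable σ)
        (ν : Measure (EuclideanSpace ℝ (Fin d))) [IsProbabilityMeasure ν]
        (X : Set (EuclideanSpace ℝ (Fin d)))
        (_ : ∀ x ∈ X, MemLp (fun w => σ ⟪w, x⟫_ℝ) 2 ν ∧ nngpKernel σ ν x x ≤ κ)
        (ℓ : ℝ → ℝ → ℝ) (_ : IsLipschitzLoss ℓ b)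
        (g : EuclideanSpace ℝ (Fin d) → ℝ) (_ : Measurable g) (M : ℝ)
        (D : Measure (EuclideanSpace ℝ (Fin d))) [IsProbabilityMeasure D]
        (_ : ∀ᵐ x ∂D, x ∈ X) (_ : GramBound σ ν D g M)
        (ε δ : ℝ) (_ : 0 < ε) (_ : 0 < δ) (_ : δ < 1),
        ∀ᶠ m : ℕ in atTop, ∀ η : ℝ, 0 < η → η < η₀ → ∀ᶠ T : ℕ in atTop,
          (sampleComplexity (sgdLearner σ ν m η T) D ℓ g ε δ : ℝ≥0∞)
            ≤ ENNReal.ofReal (C * (M + Real.log δ⁻¹) / ε ^ 2) := by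
  -- Strictly above `κ`, to absorb finite-width error, and positive for every real `κ`.
  set K : ℝ := max κ 0 + 1 with hK
  have hK1 : 1 ≤ K := by linarith [le_max_right κ 0]
  have hK0 : 0 < K := by linarith
  have hκK : κ < K := by linarith [le_max_left κ 0]
  set c : ℝ := max b 1 with hc
  have hc0 : 0 < c := lt_max_of_lt_right one_pos
  -- The first term controls the expected deviation, the second the McDiarmid tail.
  set C : ℝ := 512 * K + 32 * c ^ 2 with hC
  have hCK : 512 * K ≤ C := by rw [hC]; nlinarith
  have hCc : 32 * c ^ 2 ≤ C := by rw [hC]; linarith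
  have hC0 : 0 < C := by linarith
  refine ⟨C, K⁻¹, hC0, inv_pos.2 hK0, ?_⟩
  intro d σ hσ ν _ X hX ℓ hℓ g hg M D _ hDX hG ε δ hε hδ0 hδ1
  have hD : ∀ᵐ x ∂D, MemLp (fun w => σ ⟪w, x⟫_ℝ) 2 ν ∧ nngpKernel σ ν x x ≤ κ := by
    filter_upwards [hDX] with x hx using hX x hx
  have hM0 : 0 ≤ M := hG.nonneg
  set L := Real.log δ⁻¹ with hL
  have hL0 : 0 < L := Real.log_pos ((one_lt_inv₀ hδ0).2 hδ1)
  have hδL : δ = Real.exp (-L) := by rw [hL, Real.log_inv, neg_neg, Real.exp_log hδ0]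
  set Q := C * (M + L) / ε ^ 2 with hQ
  have hQ0 : 0 < Q := by positivity
  have hQε : Q * ε ^ 2 = C * (M + L) := by rw [hQ]; field_simp
  rcases lt_or_ge Q 1 with hQ1 | hQ1
  · have hfl : ⌊Q⌋₊ = 0 := Nat.floor_eq_zero.2 hQ1
    refine Eventually.of_forall fun m η _ _ => Eventually.of_forall fun T => ?_
    refine sampleComplexity_le hQ0.le ?_
    rw [hfl]
    refine learnsFrom_zero ν D (κ := K) (hD.mono fun x hx => hx.2.trans hκK.le) hG hℓ hε hδ0 ?_ m η T
    have h1 : Q * ε ^ 2 < 1 * ε ^ 2 := mul_lt_mul_of_pos_right hQ1 (by positivity)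
    have h2 : K * (M + L) ≤ C * (M + L) :=
      mul_le_mul_of_nonneg_right (by linarith) (by linarith)
    have h3 : 0 < K * L := by positivity
    linarith
  · set n := ⌊Q⌋₊ with hn
    have hn0 : 0 < n := Nat.floor_pos.2 hQ1
    have hn1 : (1 : ℝ) ≤ n := by exact_mod_cast hn0
    -- Rounding down costs at most a factor `2` because `n ≥ 1`.
    have hQn : Q ≤ 2 * n := by linarith [Nat.lt_floor_add_one Q]
    have hnε : C * (M + L) ≤ 2 * (n * ε ^ 2) := by
      rw [← hQε]
      have := mul_le_mul_of_nonneg_right hQn (sq_nonneg ε)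
      linarith
    -- The choice `θ = ε / (8 * K)` makes each of the two terms at most `n * ε / 8`.
    have ht : ε / (8 * K) * (n * K) + 4 * (M + L) / (ε / (8 * K)) ≤ n * (ε / 4) := by
      have e1 : ε / (8 * K) * (n * K) = n * ε / 8 := by field_simp
      have e2 : 4 * (M + L) / (ε / (8 * K)) = 32 * (K * (M + L)) / ε := by field_simp; ring
      have e3 : 32 * (K * (M + L)) / ε ≤ n * ε / 8 := by
        rw [div_le_iff₀ hε]
        have := mul_le_mul_of_nonneg_right hCK (show 0 ≤ M + L by linarith)
        linarith
      rw [e1, e2]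
      linarith
    have hp : Real.exp (-(2 * (n * (ε / 4)) ^ 2 / (n * c ^ 2))) < δ := by
      rw [hδL, Real.exp_lt_exp, neg_lt_neg_iff]
      have e1 : 2 * (n * (ε / 4)) ^ 2 / (n * c ^ 2) = n * ε ^ 2 / (8 * c ^ 2) := by
        field_simp
        ring
      rw [e1, lt_div_iff₀ (by positivity)]
      have h1 := mul_le_mul_of_nonneg_right hCc (show 0 ≤ M + L by linarith)
      have h2 : 0 < c ^ 2 * L := by positivity
      have h3 : 0 ≤ c ^ 2 * M := by positivity
      linarith
    -- `M' = M + L` exceeds `M` strictly since `L > 0`, and it is already paid for in the bound.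
    have hmain := eventually_learnsFrom hσ ν D hD hK0 hκK hg (M' := M + L) (by linarith) hM0 hG
      (hℓ.mono (le_max_left b 1)) hc0 hn0 hε hδ1 (show 0 < ε / (8 * K) by positivity) ht hp
    filter_upwards [hmain] with m hm η hη hηK
    have : η * K ≤ 1 := by
      have := mul_le_mul_of_nonneg_right hηK.le hK0.le
      rwa [inv_mul_cancel₀ hK0.ne'] at this
    filter_upwards [hm η hη this] with T hT
    exact sampleComplexity_le hQ0.le hT
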